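/- Let $p$ be an odd prime, and let $T$ be the $p$-adic rooted tree, whose vertices are the words over $X=\{1,\ldots,p\}$. For $G\le\mathrm{Aut}(T)$, let $\mathrm{St}_G(u)$ be the stabiliser of a vertex $u$, let $\mathrm{St}_G(n)$ be the subgroup of elements fixing all vertices of level $n$, and let $\psi_1\colon \mathrm{St}_{\mathrm{Aut}(T)}(1)\to \mathrm{Aut}(T)\times\overset{p}{\cdots}\times\mathrm{Aut}(T)$ be the isomorphism given by restriction to the subtrees rooted at the vertices $1,\ldots,p$ of level $1$, each identified with $T$. For each $j\in\{1,\ldots,p\}$ let $r_j\in\{0,1,\ldots,p-1\}$, with $r_j\neq 0$ for at least one $j$, and let $\mathbf e^{(j)}_1,\ldots,\mathbf e^{(j)}_{r_j}$ be linearly independent vectors $\mathbf e^{(j)}_i=(e^{(j)}_{i,1},\ldots,e^{(j)}_{i,p-1})\in(\mathbb F_p)^{p-1}$. Let $a\in\mathrm{Aut}(T)$ be the rooted automorphism that permutes the vertices of level $1$ (with the subtrees below them) according to the $p$-cycle $(1\;2\;\cdots\;p)$, and let $b^{(j)}_i\in \mathrm{St}_{\mathrm{Aut}(T)}(1)$ be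 the automorphism determined by $$\psi_1(b^{(j)}_i)=\big(a^{e^{(j)}_{i,j}},\ldots,a^{e^{(j)}_{i,p-1}},\,b^{(j)}_i,\,a^{e^{(j)}_{i,1}},\ldots,a^{e^{(j)}_{i,j-1}}\big),$$ with $b^{(j)}_i$ in coordinate $p-j+1$. Let $G=\langle \{a\}\cup\{b^{(j)}_i\mid 1\le j\le p,\ 1\le i\le r_j\}\rangle$ (a multi-EGS group in standard form), and let $\mathbf V$ be the span in $(\mathbb F_p)^{p-1}$ of all the defining vectors $\mathbf e^{(j)}_i$. The vector $\mathbf e^{(j)}_i$ is called symmetric if $e^{(j)}_{i,k}=e^{(j)}_{i,p-k}$ for all $1\le k\le\frac{p-1}{2}$, and non-symmetric otherwise. A group $G\le\mathrm{Aut}(T)$ is regular branch over a subgroup $K$ if all of the following hold: $G$ acts transitively on every level of $T$; for every $n$, the rigid level stabiliser $\mathrm{Rist}_G(n)=\prod_{|u|=n}\mathrm{Rist}_G(u)$ has finite index in $G$, where $\mathrm{Rist}_G(u)$ consists of the elements of $G$ that fix every vertex not having $u$ as a prefix; $G$ is self-similar, that is, for every vertex $u$ the restriction of each element of $\mathrm{St}_G(u)$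 to the subtree rooted at $u$, identified with $T$, lies in $G$; and $1\ne K\le \mathrm{St}_G(1)$, $K\times\overset{p}{\cdots}\times K\subseteq\psi_1(K)$ and $|G:K|<\infty$. Then $G$ is regular branch over its derived subgroup $G'$ if and only if at least one of the following conditions holds: (i) for some $j\in\{1,\ldots,p\}$ with $r_j\neq 0$, at least one of the vectors $\mathbf e^{(j)}_1,\ldots,\mathbf e^{(j)}_{r_j}$ is non-symmetric; (ii) $\dim\mathbf V\ge 2$. -/

import Mathlib

namespace MultiEGS

/-- The automorphism group of the rooted tree with vertex set the free monoid `X^*` (words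
`List X`, root `[]`, an edge from `ω` to `ωx` for each letter `x`): the bijections of the vertex
set that preserve the prefix relation in both directions.
The product is composition of maps, `(f * g) u = f (g u)`. -/
abbrev TreeAut (X : Type) : Type :=
  (List.IsPrefix : List X → List X → Prop) ≃r (List.IsPrefix : List X → List X → Prop)

section General

variable {X : Type}

theorem length_le_apply (f : TreeAut X) (u : List X) : u.length ≤ (f u).length := by
  induction u using List.reverseRecOn with
  | nil => simp
  | append_singleton w x ih =>
    have h1 : f w <+: f (w ++ [x]) := f.map_rel_iff.2 (List.prefix_append w [x])
    have h2 : f w ≠ f (w ++ [x]) := fun h => by simpa using f.injective h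
    have h3 : (f w).length ≠ (f (w ++ [x])).length := fun h => h2 (h1.eq_of_length h)
    have h4 := h1.length_le
    simp only [List.length_append, List.length_singleton]
    omega

theorem length_apply (f : TreeAut X) (u : List X) : (f u).length = u.length := by
  refine le_antisymm ?_ (length_le_apply f u)
  simpa using length_le_apply f.symm (f u)

theorem append_drop_apply (f : TreeAut X) (u v : List X) :
    f u ++ (f (u ++ v)).drop u.length = f (u ++ v) := by
  obtain ⟨t, ht⟩ : f u <+: f (u ++ v) := f.map_rel_iff.2 (List.prefix_append u v)
  rw [← ht, ← length_apply f u, List.drop_left]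

theorem append_drop_symm_apply (f : TreeAut X) (u v : List X) :
    u ++ (f.symm (f u ++ v)).drop u.length = f.symm (f u ++ v) := by
  have h := append_drop_apply f.symm (f u) v
  rwa [RelIso.symm_apply_apply, length_apply] at h

/-- The section `f_u` of `f` at the vertex `u`: the automorphism of the tree with
`f (uv) = f(u) f_u(v)` for all words `v`. -/
def treeSection (f : TreeAut X) (u : List X) : TreeAut X where
  toFun v := (f (u ++ v)).drop u.length
  invFun v := (f.symm (f u ++ v)).drop u.length
  left_inv v := by
    simp only [append_drop_apply, RelIso.symm_apply_apply, List.drop_left]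
  right_inv v := by
    simp only [append_drop_symm_apply, RelIso.apply_symm_apply]
    rw [← length_apply f u, List.drop_left]
  map_rel_iff' := by
    intro v w
    change (f (u ++ v)).drop u.length <+: (f (u ++ w)).drop u.length ↔ v <+: w
    rw [← List.prefix_append_right_inj (f u), append_drop_apply, append_drop_apply,
      f.map_rel_iff, List.prefix_append_right_inj]

theorem apply_append (f : TreeAut X) (u v : List X) :
    f (u ++ v) = f u ++ treeSection f u v :=
  (append_drop_apply f u v).symm

theorem treeSection_mul (f g : TreeAut X) (u : List X) :
    treeSection (f * g) u = treeSection f (g u) * treeSection g u := by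
  ext1 v
  have h : (f * g) (u ++ v) = (f * g) u ++ treeSection (f * g) u v := apply_append _ _ _
  have h' : f (g (u ++ v)) = f (g u) ++ treeSection f (g u) (treeSection g u v) := by
    rw [apply_append g, apply_append f]
  exact List.append_cancel_left (h.symm.trans h')

theorem treeSection_one (u : List X) : treeSection (1 : TreeAut X) u = 1 := by
  ext1 v
  exact List.drop_left

/-- The vertex stabiliser `St_G(u)`. -/
def vertexStabilizer (G : Subgroup (TreeAut X)) (u : List X) : Subgroup (TreeAut X) where
  carrier := {g | g ∈ G ∧ g u = u}
  mul_mem' := by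
    rintro f g ⟨hf, hfu⟩ ⟨hg, hgu⟩
    refine ⟨G.mul_mem hf hg, ?_⟩
    change f (g u) = u
    rw [hgu, hfu]
  one_mem' := ⟨G.one_mem, rfl⟩
  inv_mem' := by
    rintro f ⟨hf, hfu⟩
    refine ⟨G.inv_mem hf, ?_⟩
    change f.symm u = u
    rw [RelIso.symm_apply_eq, hfu]

/-- The `n`th level stabiliser `St_G(n)`: the elements of `G` that fix all vertices of
level `n`. -/
def levelStabilizer (G : Subgroup (TreeAut X)) (n : ℕ) : Subgroup (TreeAut X) :=
  G ⊓ ⨅ (u : List X) (_ : u.length = n), vertexStabilizer G u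

theorem mem_levelStabilizer {G : Subgroup (TreeAut X)} {n : ℕ} {g : TreeAut X} :
    g ∈ levelStabilizer G n ↔ g ∈ G ∧ ∀ u : List X, u.length = n → g u = u := by
  simp only [levelStabilizer, Subgroup.mem_inf, Subgroup.mem_iInf]
  exact ⟨fun h => ⟨h.1, fun u hu => (h.2 u hu).2⟩, fun h => ⟨h.1, fun u hu => ⟨h.1, h.2 u hu⟩⟩⟩

theorem apply_singleton_of_mem {G : Subgroup (TreeAut X)} {g : TreeAut X}
    (hg : g ∈ levelStabilizer G 1) (x : X) : g [x] = [x] :=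
  (mem_levelStabilizer.1 hg).2 [x] rfl

/-- The natural map `ψ_1 : St_{Aut(T)}(1) → Aut(T) × ⋯ × Aut(T)`, which sends `g` to its
restrictions to the subtrees rooted at the first level vertices. -/
def psiOne : levelStabilizer (⊤ : Subgroup (TreeAut X)) 1 →* (X → TreeAut X) where
  toFun g x := treeSection (g : TreeAut X) [x]
  map_one' := by
    funext x
    exact treeSection_one [x]
  map_mul' f g := by
    funext x
    have h := treeSection_mul (f : TreeAut X) (g : TreeAut X) [x]
    rw [apply_singleton_of_mem g.2 x] at h
    exact h

/-- `G` is self-similar: the restriction of an element of `St_G(u)` to the subtree rooted at `u`,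
identified with the whole tree, lies in `G`, for every vertex `u`. -/
def IsSelfSimilar (G : Subgroup (TreeAut X)) : Prop :=
  ∀ u : List X, ∀ g ∈ vertexStabilizer G u, treeSection g u ∈ G

/-- `G` acts transitively on every level of the tree. -/
def IsSphericallyTransitive (G : Subgroup (TreeAut X)) : Prop :=
  ∀ u v : List X, u.length = v.length → ∃ g ∈ G, g u = v

/-- The rigid vertex stabiliser `Rist_G(u)`: the elements of `G` that fix every vertex not
succeeding `u`. -/
def rigidVertexStabilizer (G : Subgroup (TreeAut X)) (u : List X) : Subgroup (TreeAut X) :=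
  G ⊓ ⨅ (v : List X) (_ : ¬ u <+: v), vertexStabilizer G v

/-- The rigid `n`th level stabiliser `Rist_G(n)`, the (internal direct) product of the rigid
stabilisers of the vertices of level `n`. -/
def rigidLevelStabilizer (G : Subgroup (TreeAut X)) (n : ℕ) : Subgroup (TreeAut X) :=
  ⨆ (u : List X) (_ : u.length = n), rigidVertexStabilizer G u

/-- `G` is a branch group. -/
def IsBranch (G : Subgroup (TreeAut X)) : Prop :=
  IsSphericallyTransitive G ∧ ∀ n : ℕ, ((rigidLevelStabilizer G n).subgroupOf G).FiniteIndex

/-- `G` is regular branch over `K`: `G` is a self-similar branch group, and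
`1 ≠ K ≤ St_G(1)` satisfies `K × ⋯ × K ⊆ ψ_1(K)` and `|G : K| < ∞`. -/
structure IsRegularBranchOver (G K : Subgroup (TreeAut X)) : Prop where
  branch : IsBranch G
  selfSimilar : IsSelfSimilar G
  ne_bot : K ≠ ⊥
  le_stabilizer : K ≤ levelStabilizer G 1
  pi_le : Subgroup.pi Set.univ (fun _ : X => K) ≤
    (K.subgroupOf (levelStabilizer (⊤ : Subgroup (TreeAut X)) 1)).map psiOne
  finiteIndex : (K.subgroupOf G).FiniteIndex

end General

section Generators

variable (p : ℕ)

/-- The rooted automorphism `a` of the tree on the alphabet `{1, …, p}` that permutes the first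
level cyclically as `(1 2 ⋯ p)`. The letters are written as residues modulo `p`. -/
def rooted : TreeAut (ZMod p) where
  toFun
    | [] => []
    | x :: w => (x + 1) :: w
  invFun
    | [] => []
    | x :: w => (x - 1) :: w
  left_inv u := by cases u <;> simp
  right_inv u := by cases u <;> simp
  map_rel_iff' := by
    intro u v
    cases u <;> cases v <;> simp

/-- Vectors `(e_1, …, e_{p-1})` over `𝔽_p`; the positions `1, …, p-1` are written as the non-zero
residues modulo `p`. -/
abbrev Vec : Type := {k : ZMod p // k ≠ 0} → ZMod p

variable {p}

/-- `e` is symmetric: `e_k = e_{p-k}` for all `k`. -/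
def Vec.IsSymmetric (e : Vec p) : Prop :=
  ∀ k : {k : ZMod p // k ≠ 0}, e k = e ⟨-k.1, neg_ne_zero.2 k.2⟩

/-- The underlying map of `directed j e`. -/
def directedFun (j : ZMod p) (e : Vec p) : List (ZMod p) → List (ZMod p)
  | [] => []
  | x :: w =>
    if h : x - (1 - j) = 0 then x :: directedFun j e w
    else x :: (rooted p ^ (e ⟨x - (1 - j), h⟩).val) w

/-- The inverse of `directedFun j e`. -/
def directedInv (j : ZMod p) (e : Vec p) : List (ZMod p) → List (ZMod p)
  | [] => []
  | x :: w =>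
    if h : x - (1 - j) = 0 then x :: directedInv j e w
    else x :: (rooted p ^ (e ⟨x - (1 - j), h⟩).val).symm w

/-- The directed automorphism `b` in the `j`th family with defining vector `e`, given by
`ψ_1(b) = (a^{e_j}, …, a^{e_{p-1}}, b, a^{e_1}, …, a^{e_{j-1}})`. Thus the coordinate of `ψ_1(b)`
at the letter `p - j + 1` is `b`, and the one at a letter `x ≠ p - j + 1` is `a^{e_k}` with
`k ≡ x - (p - j + 1)` modulo `p`. The index `j ∈ {1, …, p}` is written as a residue
modulo `p`. -/
def directed (j : ZMod p) (e : Vec p) : TreeAut (ZMod p) where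
  toFun := directedFun j e
  invFun := directedInv j e
  left_inv u := by
    induction u with
    | nil => rfl
    | cons x w ih =>
      by_cases h : x - (1 - j) = 0
      · simp only [directedFun, directedInv, dif_pos h, ih]
      · simp only [directedFun, directedInv, dif_neg h, RelIso.symm_apply_apply]
  right_inv u := by
    induction u with
    | nil => rfl
    | cons x w ih =>
      by_cases h : x - (1 - j) = 0
      · simp only [directedFun, directedInv, dif_pos h, ih]
      · simp only [directedFun, directedInv, dif_neg h, RelIso.apply_symm_apply]
  map_rel_iff' := by
    intro u
    change ∀ {v}, directedFun j e u <+: directedFun j e v ↔ u <+: v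
    induction u with
    | nil => intro v; simp [directedFun]
    | cons x w ih =>
      intro v
      cases v with
      | nil => by_cases h : x - (1 - j) = 0 <;> simp [directedFun, h]
      | cons y v =>
        by_cases hxy : x = y
        · subst hxy
          by_cases h : x - (1 - j) = 0
          · simp only [directedFun, dif_pos h, List.cons_prefix_cons, ih]
          · simp only [directedFun, dif_neg h, List.cons_prefix_cons, true_and]
            exact RelIso.map_rel_iff _
        · by_cases h : x - (1 - j) = 0 <;> by_cases h' : y - (1 - j) = 0 <;>
            simp only [directedFun, h, h', dite_true, dite_false, List.cons_prefix_cons, hxy,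
              false_and]

theorem directed_mem (j : ZMod p) (e : Vec p) :
    directed j e ∈ levelStabilizer (⊤ : Subgroup (TreeAut (ZMod p))) 1 := by
  refine mem_levelStabilizer.2 ⟨trivial, fun u hu => ?_⟩
  obtain ⟨x, rfl⟩ := List.length_eq_one_iff.1 hu
  change directedFun j e [x] = [x]
  by_cases h : x - (1 - j) = 0
  · simp only [directedFun, dif_pos h]
  · simp only [directedFun, dif_neg h, List.cons.injEq, true_and]
    exact List.eq_nil_of_length_eq_zero (length_apply _ _)

/-- The recursive relation that determines the directed automorphisms. -/
theorem psiOne_directed (j : ZMod p) (e : Vec p) :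
    psiOne ⟨directed j e, directed_mem j e⟩ = fun x =>
      if h : x - (1 - j) = 0 then directed j e
      else rooted p ^ (e ⟨x - (1 - j), h⟩).val := by
  funext x
  ext1 w
  change (directedFun j e ([x] ++ w)).drop 1 = _
  by_cases h : x - (1 - j) = 0
  · simp only [List.singleton_append, directedFun, dif_pos h, List.drop_one, List.tail_cons]
    rfl
  · simp only [List.singleton_append, directedFun, dif_neg h, List.drop_one, List.tail_cons]

end Generators

/-- The numerical datum `𝐄 = (𝐄^{(1)}, …, 𝐄^{(p)})`: each `𝐄^{(j)}` is an `r_j`-tuple of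
linearly independent vectors of `(𝔽_p)^{p-1}`, with `0 ≤ r_j ≤ p - 1` and `r_j ≠ 0` for at least
one `j`. -/
structure NumericalDatum (p : ℕ) where
  r : ZMod p → ℕ
  r_le : ∀ j, r j ≤ p - 1
  exists_r_ne_zero : ∃ j, r j ≠ 0
  vec : (j : ZMod p) → Fin (r j) → Vec p
  linearIndependent : ∀ j, LinearIndependent (ZMod p) (vec j)

namespace NumericalDatum

variable {p : ℕ} (E : NumericalDatum p)

/-- The multi-EGS group `G_𝐄` in standard form. -/
def group : Subgroup (TreeAut (ZMod p)) :=
  Subgroup.closure ({rooted p} ∪ {b | ∃ (j : ZMod p) (i : Fin (E.r j)), b = directed j (E.vec j i)})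

/-- The span `𝐕` of all defining vectors. -/
def span : Submodule (ZMod p) (Vec p) :=
  Submodule.span (ZMod p) {v | ∃ (j : ZMod p) (i : Fin (E.r j)), v = E.vec j i}

end NumericalDatum

end MultiEGS

/-!
The group `G` of the datum `E` is self-similar, acts transitively on all levels and has a finite
abelianisation, so it is regular branch over `G'` if and only if `G' × ⋯ × G' ⊆ ψ₁(G')`
(`NumericalDatum.isRegularBranchOver`). As `G` is fractal, this inclusion says that `G'` lies in the
subgroup `localCommutator` of those `k` for which the automorphism acting as `k` on one first level
subtree, and trivially elsewhere, belongs to `G'`; this subgroup is normalised by `G`.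

Suppose that there is a non-symmetric defining vector or that the span has dimension at least two.
The directed elements `b`, `b'` with distinguished letters moved to `x` and `x - d` have a
commutator supported on these two letters, with sections `[b, a ^ e'_d]` and `[a ^ e_{-d}, b']`
(`linked_commutator`). Hence `[b, a ^ e'_d]` at `x` may be replaced by `[b', a ^ e_{-d}]` at `x - d`
modulo `G'`, and conjugation by `b` or by a power of `a` is replaced by conjugation by a power of
`a` or by `b'` (`linked_step_rot`, `linked_step_directed`). If one of the two sections is trivial,
the other one lies in `localCommutator`, and then all commutators do
(`commutator_le_localCommutator`). Otherwise such replacements can be composed along cycles of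
letters, which yields relations between commutators at one and the same letter: their parameters,
and those of the conjugating elements, are rescaled, with factors that are not all trivial if `e` is
non-symmetric, or if `e` and `e'` are linearly independent and symmetric. Modulo `localCommutator`
the commutators therefore commute with `a` or with the directed elements, according to which factor
is non-trivial. This makes them additive in the corresponding parameter, and invariance under the
rescaling makes them trivial; if all factors are `-1`, an additional relation which exchanges the
roles of `a` and the directed elements is needed (`commutator_eq_one_of_rescaling`,
`commutator_eq_one_of_swap`).

Conversely, suppose that all defining vectors are multiples of one symmetric vector `v`. The
labels of `g` at the first level form a vector in the cyclic `𝔽_p[C_p]`-module generated by `v`.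
The last two non-vanishing iterated differences, evaluated at `0`, give functions `ε` and `η` on
`G`, where `ε` is a homomorphism and `η (f * g) = η f + (root label of g) * ε f + η g`, and `η`
does not vanish on the commutator of `a` and a directed generator. The sum of `η` over the
sections of an element fails to be additive only by a bilinear form in the `ε`-values of the
sections. The matrix of this form is given by `v`, so it is symmetric, and subtracting half of the
associated quadratic form gives a homomorphism from `G` to `𝔽_p`. It vanishes on `G'`, but not on
`[a, b]` placed on a single subtree (`not_commutator_le_localCommutator`).
-/

namespace MultiEGS

open scoped commutatorElement

/-! ### Automorphisms with prescribed sections -/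

section Tree

variable {X : Type}

theorem apply_nil (f : TreeAut X) : f [] = [] :=
  List.eq_nil_of_length_eq_zero (length_apply f [])

theorem apply_cons (f : TreeAut X) (x : X) (w : List X) :
    f (x :: w) = f [x] ++ treeSection f [x] w :=
  apply_append f [x] w

theorem treeSection_append (f : TreeAut X) (u v : List X) :
    treeSection f (u ++ v) = treeSection (treeSection f u) v := by
  ext1 w
  have h := apply_append f (u ++ v) w
  rw [apply_append f u v, List.append_assoc u, apply_append f u, apply_append _ v,
    List.append_assoc] at h
  exact (List.append_cancel_left (List.append_cancel_left h)).symm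

theorem treeSection_nil (f : TreeAut X) : treeSection f [] = f := by
  ext1 w
  rfl

/-- The automorphism that fixes the first level and has prescribed sections there; this is the
inverse of `psiOne`. -/
def diag : (X → TreeAut X) →* TreeAut X where
  toFun k :=
    { toFun := fun
        | [] => []
        | x :: w => x :: k x w
      invFun := fun
        | [] => []
        | x :: w => x :: (k x).symm w
      left_inv := fun u => by cases u <;> simp
      right_inv := fun u => by cases u <;> simp
      map_rel_iff' := by
        intro u v
        cases u with
        | nil => simp
        | cons x u =>
          cases v with
          | nil => simp
          | cons y v =>
            by_cases hxy : x = y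
            · subst hxy
              simpa using (k x).map_rel_iff
            · simp [List.cons_prefix_cons, hxy] }
  map_one' := by
    ext1 u
    cases u <;> rfl
  map_mul' k l := by
    ext1 u
    cases u <;> rfl

theorem diag_cons (k : X → TreeAut X) (x : X) (w : List X) : diag k (x :: w) = x :: k x w := rfl

theorem diag_singleton (k : X → TreeAut X) (x : X) : diag k [x] = [x] := by
  rw [diag_cons, apply_nil]

theorem treeSection_diag (k : X → TreeAut X) (x : X) : treeSection (diag k) [x] = k x := by
  ext1 w
  rfl

theorem diag_treeSection {g : TreeAut X} (hg : ∀ x, g [x] = [x]) :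
    diag (fun x => treeSection g [x]) = g := by
  ext1 u
  cases u with
  | nil => rw [apply_nil, apply_nil]
  | cons x w => rw [diag_cons, apply_cons g, hg, List.singleton_append]

theorem diag_mem_levelStabilizer (k : X → TreeAut X) :
    diag k ∈ levelStabilizer (⊤ : Subgroup (TreeAut X)) 1 := by
  refine mem_levelStabilizer.2 ⟨trivial, fun u hu => ?_⟩
  obtain ⟨x, rfl⟩ := List.length_eq_one_iff.1 hu
  exact diag_singleton k x

theorem psiOne_diag (k : X → TreeAut X) : psiOne ⟨diag k, diag_mem_levelStabilizer k⟩ = k := by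
  funext x
  exact treeSection_diag k x

variable [DecidableEq X]

/-- The automorphism that acts as `k` on the subtree rooted at the first level vertex `x` and
trivially elsewhere. -/
def atLetter (x : X) : TreeAut X →* TreeAut X :=
  diag.comp (MonoidHom.mulSingle (fun _ : X => TreeAut X) x)

theorem atLetter_eq (x : X) (k : TreeAut X) : atLetter x k = diag (Pi.mulSingle x k) := rfl

theorem treeSection_atLetter (x y : X) (k : TreeAut X) :
    treeSection (atLetter x k) [y] = if y = x then k else 1 := by
  rw [atLetter_eq, treeSection_diag, Pi.mulSingle_apply]

theorem diag_mul_atLetter_mul_inv (g : X → TreeAut X) (x : X) (k : TreeAut X) :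
    diag g * atLetter x k * (diag g)⁻¹ = atLetter x (g x * k * (g x)⁻¹) := by
  rw [atLetter_eq, atLetter_eq, ← map_inv, ← map_mul, ← map_mul]
  congr 1
  funext y
  by_cases h : y = x
  · subst h; simp
  · simp [h]

/-- The automorphism that acts as `k` on the subtree rooted at the vertex `u` and trivially
elsewhere. -/
def atVertex : List X → TreeAut X →* TreeAut X
  | [] => MonoidHom.id _
  | x :: u => (atLetter x).comp (atVertex u)

theorem atVertex_apply_of_not_prefix (u : List X) (k : TreeAut X) {v : List X} (h : ¬ u <+: v) :
    atVertex u k v = v := by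
  induction u generalizing v with
  | nil => exact absurd v.nil_prefix h
  | cons x u ih =>
    cases v with
    | nil => exact apply_nil _
    | cons y v =>
      change diag (Pi.mulSingle x (atVertex u k)) (y :: v) = y :: v
      rw [diag_cons]
      by_cases hxy : y = x
      · subst hxy
        rw [Pi.mulSingle_eq_same, ih]
        simpa [List.cons_prefix_cons] using h
      · rw [Pi.mulSingle_eq_of_ne hxy]
        rfl

/-- If an automorphism fixes a level and its sections there lie in `K`, then it is a product of
elements of `K` acting on the subtrees rooted at that level. -/
theorem mem_iSup_map_atVertex [Finite X] (K : Subgroup (TreeAut X)) (n : ℕ) {g : TreeAut X}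
    (hg : ∀ u : List X, u.length = n → g u = u ∧ treeSection g u ∈ K) :
    g ∈ ⨆ (u : List X) (_ : u.length = n), K.map (atVertex u) := by
  induction n generalizing g with
  | zero =>
    refine Subgroup.mem_iSup_of_mem [] (Subgroup.mem_iSup_of_mem rfl ⟨g, ?_, rfl⟩)
    have h := (hg [] rfl).2
    rwa [treeSection_nil] at h
  | succ n ih =>
    by_cases hX : Nonempty X
    · have hfix : ∀ x, g [x] = [x] := by
        intro x
        have h := (hg (x :: List.replicate n x) (by simp)).1
        rw [apply_cons] at h
        exact (List.append_inj (h.trans (List.singleton_append).symm)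
          (length_apply g [x])).1
      have hpi : (Subgroup.pi Set.univ
          fun _ : X => ⨆ (u : List X) (_ : u.length = n), K.map (atVertex u)) ≤
          (⨆ (u : List X) (_ : u.length = n + 1), K.map (atVertex u)).comap diag := by
        rw [Subgroup.pi_le_iff]
        intro x
        rw [← Subgroup.map_le_iff_le_comap, Subgroup.map_map, Subgroup.map_iSup, iSup_le_iff]
        intro u
        rw [Subgroup.map_iSup, iSup_le_iff]
        intro hu
        rw [Subgroup.map_map]
        exact le_iSup₂_of_le (x :: u) (by simp [hu]) le_rfl
      have hmem : (fun x => treeSection g [x]) ∈ (Subgroup.pi Set.univ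
          fun _ : X => ⨆ (u : List X) (_ : u.length = n), K.map (atVertex u)) := by
        intro x _
        refine ih fun u hu => ?_
        obtain ⟨h1, h2⟩ := hg (x :: u) (by simp [hu])
        rw [apply_cons, hfix, List.singleton_append, List.cons.injEq] at h1
        exact ⟨h1.2, by rwa [← treeSection_append]⟩
      have h := hpi hmem
      rwa [Subgroup.mem_comap, diag_treeSection hfix] at h
    · have hg1 : g = 1 := by
        ext1 u
        cases u with
        | nil => exact apply_nil g
        | cons x _ => exact absurd ⟨x⟩ hX
      rw [hg1]
      exact Subgroup.one_mem _

end Tree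

/-! ### Rigid level stabilisers and finite index -/

section Branch

variable {X : Type}

theorem commutator_le_self (G : Subgroup (TreeAut X)) : ⁅G, G⁆ ≤ G := by
  rw [Subgroup.commutator_le]
  intro g hg h hh
  exact G.mul_mem (G.mul_mem (G.mul_mem hg hh) (G.inv_mem hg)) (G.inv_mem hh)

theorem conj_mem_commutator {G : Subgroup (TreeAut X)} {g h : TreeAut X} (hg : g ∈ G)
    (hh : h ∈ ⁅G, G⁆) : g * h * g⁻¹ ∈ ⁅G, G⁆ := by
  have h1 := Subgroup.mul_mem _
    (Subgroup.commutator_mem_commutator hg (commutator_le_self G hh)) hh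
  rwa [commutatorElement_def, inv_mul_cancel_right] at h1

theorem atVertex_mem [DecidableEq X] {K : Subgroup (TreeAut X)}
    (hK : ∀ x, ∀ k ∈ K, atLetter x k ∈ K) (u : List X) {k : TreeAut X} (hk : k ∈ K) :
    atVertex u k ∈ K := by
  induction u with
  | nil => exact hk
  | cons x u ih => exact hK x _ ih

/-- The subgroup of `G` of the elements fixing level `n` whose sections there lie in a finite index
subgroup has finite index: an element modulo this subgroup is determined by the permutation of
level `n` and the cosets of its sections. If `K` contains a copy of itself on each subtree of the
first level, this subgroup lies in the rigid level stabiliser. -/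
theorem finiteIndex_rigidLevelStabilizer [Finite X] [DecidableEq X] {G K : Subgroup (TreeAut X)}
    (hsec : ∀ g ∈ G, ∀ u, treeSection g u ∈ G) (hKG : K ≤ G)
    (hK : ∀ x, ∀ k ∈ K, atLetter x k ∈ K) (hfin : (K.subgroupOf G).FiniteIndex) (n : ℕ) :
    ((rigidLevelStabilizer G n).subgroupOf G).FiniteIndex := by
  have hle : ∀ g : TreeAut X, (∀ u : List X, u.length = n → g u = u ∧ treeSection g u ∈ K) →
      g ∈ rigidLevelStabilizer G n := by
    intro g hg
    refine (iSup₂_mono fun u _ => ?_ : (⨆ (u : List X) (_ : u.length = n), K.map (atVertex u)) ≤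
      rigidLevelStabilizer G n) (mem_iSup_map_atVertex K n hg)
    rintro _ ⟨k, hk, rfl⟩
    have hkG : atVertex u k ∈ G := hKG (atVertex_mem hK u hk)
    refine Subgroup.mem_inf.2 ⟨hkG, ?_⟩
    simp only [Subgroup.mem_iInf]
    exact fun v hv => ⟨hkG, atVertex_apply_of_not_prefix u k hv⟩
  let φ : G → (List.Vector X n → List.Vector X n × (G ⧸ K.subgroupOf G)) := fun g u =>
    (⟨(g : TreeAut X) u.1, (length_apply _ _).trans u.2⟩,
      QuotientGroup.mk ⟨treeSection (g : TreeAut X) u.1, hsec g g.2 u.1⟩)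
  have hφ : ∀ g h : G, φ g = φ h → g⁻¹ * h ∈ (rigidLevelStabilizer G n).subgroupOf G := by
    intro g h hgh
    refine Subgroup.mem_subgroupOf.2 (hle _ fun u hu => ?_)
    have h1 := congrFun hgh ⟨u, hu⟩
    have h2 := congrArg Prod.snd h1
    replace h1 : (g : TreeAut X) u = (h : TreeAut X) u :=
      congrArg Subtype.val (congrArg Prod.fst h1)
    simp only [φ] at h2
    rw [QuotientGroup.eq, Subgroup.mem_subgroupOf] at h2
    have h3 : ((g : TreeAut X)⁻¹) ((h : TreeAut X) u) = u := by
      rw [← h1]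
      exact RelIso.symm_apply_apply _ _
    refine ⟨h3, ?_⟩
    have h4 : treeSection ((g : TreeAut X)⁻¹) ((h : TreeAut X) u) =
        (treeSection (g : TreeAut X) u)⁻¹ := by
      rw [eq_inv_iff_mul_eq_one, ← h1, ← treeSection_mul, inv_mul_cancel, treeSection_one]
    change treeSection ((g : TreeAut X)⁻¹ * (h : TreeAut X)) u ∈ K
    rw [treeSection_mul, h4]
    exact h2
  have hfin' : Finite (G ⧸ K.subgroupOf G) := Subgroup.finite_quotient_of_finiteIndex
  have hinj : Function.Injective fun q : G ⧸ (rigidLevelStabilizer G n).subgroupOf G =>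
      φ q.out := by
    intro q r hqr
    have h := hφ _ _ hqr
    rwa [← QuotientGroup.eq, QuotientGroup.out_eq', QuotientGroup.out_eq'] at h
  have hfinite : Finite (List.Vector X n) := inferInstance
  have : Finite (G ⧸ (rigidLevelStabilizer G n).subgroupOf G) := Finite.of_injective _ hinj
  exact Subgroup.finiteIndex_of_finite_quotient

/-- A group generated by finitely many elements of finite order has a finite abelianisation. -/
theorem finiteIndex_commutator_of_torsion {Γ : Type*} [Group Γ] {S : Set Γ} (hS : S.Finite) {n : ℕ}
    (hn : 0 < n) (hpow : ∀ s ∈ S, s ^ n = 1) :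
    (⁅Subgroup.closure S, Subgroup.closure S⁆.subgroupOf (Subgroup.closure S)).FiniteIndex := by
  set G := Subgroup.closure S with hG
  have hcomm : (⁅G, G⁆ : Subgroup Γ).subgroupOf G = commutator G := by
    rw [← Subgroup.map_subtype_commutator, Subgroup.subgroupOf,
      Subgroup.comap_map_eq_self_of_injective G.subtype_injective]
  rw [hcomm]
  have hfg : Group.FG G := (Group.fg_iff_subgroup_fg G).2
    ((Subgroup.fg_iff G).2 ⟨S, hG.symm, hS⟩)
  have hfgA : Group.FG (Abelianization G) := QuotientGroup.fg (commutator G)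
  have htors : IsMulTorsion (Abelianization G) := by
    have key : ∀ (g : Γ) (hg : g ∈ G), (Abelianization.of (⟨g, hg⟩ : G)) ^ n = 1 := by
      intro g hg
      induction hg using Subgroup.closure_induction with
      | mem s hs =>
        rw [← map_pow]
        have : (⟨s, Subgroup.subset_closure hs⟩ : G) ^ n = 1 := Subtype.ext (hpow s hs)
        rw [this, map_one]
      | one => exact (congrArg (· ^ n) (map_one Abelianization.of)).trans (one_pow n)
      | mul x y hx hy ihx ihy =>
        have : (⟨x * y, G.mul_mem hx hy⟩ : G) = ⟨x, hx⟩ * ⟨y, hy⟩ := rfl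
        rw [this, map_mul, mul_pow, ihx, ihy, one_mul]
      | inv x hx ih =>
        have : (⟨x⁻¹, G.inv_mem hx⟩ : G) = ⟨x, hx⟩⁻¹ := rfl
        rw [this, map_inv, inv_pow, ih, inv_one]
    intro q
    obtain ⟨⟨g, hg⟩, rfl⟩ := QuotientGroup.mk_surjective q
    exact isOfFinOrder_iff_pow_eq_one.2 ⟨n, hn, key g hg⟩
  have hfin : Finite (Abelianization G) := CommGroup.finite_of_fg_isMulTorsion _ htors
  exact @Subgroup.finiteIndex_of_finite_quotient _ _ _ hfin

end Branch

/-! ### The rooted and directed automorphisms -/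

section Directed

variable {p : ℕ}

/-- The vector `e` viewed as a function on all residues, with value `0` at `0`. -/
def Vec.extend : Vec p →ₗ[ZMod p] (ZMod p → ZMod p) where
  toFun e k := if h : k = 0 then 0 else e ⟨k, h⟩
  map_add' e f := by
    funext k
    by_cases h : k = 0 <;> simp [h]
  map_smul' c e := by
    funext k
    by_cases h : k = 0 <;> simp [h]

theorem Vec.extend_zero_apply (e : Vec p) : e.extend 0 = 0 := dif_pos rfl

theorem Vec.extend_of_ne (e : Vec p) {k : ZMod p} (h : k ≠ 0) : e.extend k = e ⟨k, h⟩ := dif_neg h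

theorem Vec.extend_injective : Function.Injective (Vec.extend (p := p)) := by
  intro e f h
  funext ⟨k, hk⟩
  rw [← e.extend_of_ne hk, ← f.extend_of_ne hk, h]

theorem Vec.isSymmetric_iff (e : Vec p) : e.IsSymmetric ↔ ∀ k, e.extend (-k) = e.extend k := by
  constructor
  · intro h k
    by_cases hk : k = 0
    · rw [hk, neg_zero]
    · rw [e.extend_of_ne hk, e.extend_of_ne (neg_ne_zero.2 hk)]
      exact (h ⟨k, hk⟩).symm
  · rintro h ⟨k, hk⟩
    rw [← e.extend_of_ne hk, ← e.extend_of_ne (neg_ne_zero.2 hk), h]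

variable [Fact p.Prime]

/-- The power `a ^ s` of the rooted automorphism. -/
def rot (s : ZMod p) : TreeAut (ZMod p) := rooted p ^ s.val

theorem rooted_cons (x : ZMod p) (w : List (ZMod p)) : rooted p (x :: w) = (x + 1) :: w := rfl

theorem rot_cons (s x : ZMod p) (w : List (ZMod p)) : rot s (x :: w) = (x + s) :: w := by
  have key : ∀ n : ℕ, (rooted p ^ n) (x :: w) = (x + n) :: w := by
    intro n
    induction n with
    | zero => simp
    | succ n ih =>
      rw [pow_succ']
      change rooted p ((rooted p ^ n) (x :: w)) = _
      rw [ih, rooted_cons]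
      push_cast
      rw [add_assoc]
  rw [rot, key, ZMod.natCast_zmod_val]

theorem rot_add (s t : ZMod p) : rot (s + t) = rot s * rot t := by
  ext1 u
  change _ = rot s (rot t u)
  cases u with
  | nil => rw [apply_nil, apply_nil, apply_nil]
  | cons x w => rw [rot_cons, rot_cons, rot_cons, add_assoc, add_comm s]

theorem rot_zero : rot (0 : ZMod p) = 1 := by
  rw [rot, ZMod.val_zero, pow_zero]

theorem rot_one : rot (1 : ZMod p) = rooted p := by
  have : Fact (1 < p) := ⟨(Fact.out : p.Prime).one_lt⟩
  rw [rot, ZMod.val_one, pow_one]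

theorem rot_commute (s t : ZMod p) : Commute (rot s) (rot t) := by
  rw [Commute, SemiconjBy, ← rot_add, ← rot_add, add_comm]

theorem treeSection_rot (s x : ZMod p) : treeSection (rot s) [x] = 1 := by
  ext1 w
  change (rot s (x :: w)).drop 1 = w
  rw [rot_cons, List.drop_one, List.tail_cons]

theorem rot_mul_diag_mul_inv (s : ZMod p) (k : ZMod p → TreeAut (ZMod p)) :
    rot s * diag k * (rot s)⁻¹ = diag fun y => k (y - s) := by
  rw [mul_inv_eq_iff_eq_mul]
  ext1 u
  change rot s (diag k u) = diag _ (rot s u)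
  cases u with
  | nil => simp only [apply_nil]
  | cons x w => rw [rot_cons, diag_cons, diag_cons, rot_cons, add_sub_cancel_right]

theorem rot_mul_atLetter_mul_inv (s x : ZMod p) (k : TreeAut (ZMod p)) :
    rot s * atLetter x k * (rot s)⁻¹ = atLetter (x + s) k := by
  rw [atLetter_eq, rot_mul_diag_mul_inv, atLetter_eq]
  congr 1
  funext y
  simp only [Pi.mulSingle_apply, sub_eq_iff_eq_add]

theorem directed_cons (j : ZMod p) (e : Vec p) (x : ZMod p) (w : List (ZMod p)) :
    directed j e (x :: w) =
      if x = 1 - j then x :: directed j e w else x :: rot (e.extend (x - (1 - j))) w := by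
  change directedFun j e (x :: w) = _
  by_cases h : x = 1 - j
  · rw [if_pos h, directedFun, dif_pos (sub_eq_zero.2 h)]
    rfl
  · rw [if_neg h, directedFun, dif_neg (sub_ne_zero.2 h), e.extend_of_ne (sub_ne_zero.2 h)]
    rfl

theorem directed_add (j : ZMod p) (e f : Vec p) :
    directed j (e + f) = directed j e * directed j f := by
  ext1 u
  change _ = directed j e (directed j f u)
  induction u with
  | nil => simp only [apply_nil]
  | cons x w ih =>
    by_cases h : x = 1 - j
    · simp only [directed_cons, if_pos h, ih]
    · simp only [directed_cons, if_neg h, map_add, Pi.add_apply, rot_add]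
      rfl

theorem directed_zero (j : ZMod p) : directed j (0 : Vec p) = 1 := by
  have h := directed_add j (0 : Vec p) 0
  rwa [add_zero, left_eq_mul] at h

theorem directed_nsmul (j : ZMod p) (e : Vec p) (n : ℕ) :
    directed j (n • e) = directed j e ^ n := by
  induction n with
  | zero => rw [zero_smul, pow_zero, directed_zero]
  | succ n ih => rw [succ_nsmul, pow_succ, directed_add, ih]

/-- The conjugate of `directed j e` by a power of `a` for which `directed j e` is the section at
the letter `x`. Its section at a letter `y ≠ x` is `a ^ e_{y - x}`. -/
def directedAt (x j : ZMod p) (e : Vec p) : TreeAut (ZMod p) :=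
  diag (Function.update (fun y => rot (e.extend (y - x))) x (directed j e))

theorem directedAt_self (j : ZMod p) (e : Vec p) : directedAt (1 - j) j e = directed j e := by
  ext1 u
  cases u with
  | nil => simp only [apply_nil]
  | cons x w =>
    rw [directedAt, diag_cons, directed_cons]
    by_cases h : x = 1 - j
    · rw [if_pos h, h, Function.update_self]
    · rw [if_neg h, Function.update_of_ne h]

theorem rot_mul_directedAt_mul_inv (s x j : ZMod p) (e : Vec p) :
    rot s * directedAt x j e * (rot s)⁻¹ = directedAt (x + s) j e := by
  rw [directedAt, rot_mul_diag_mul_inv, directedAt]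
  congr 1
  funext y
  by_cases h : y = x + s
  · rw [h, Function.update_self, add_sub_cancel_right, Function.update_self]
  · rw [Function.update_of_ne h, Function.update_of_ne (by rwa [ne_eq, sub_eq_iff_eq_add]),
      sub_sub, add_comm s]

theorem treeSection_directed_self (j : ZMod p) (e : Vec p) :
    treeSection (directed j e) [1 - j] = directed j e := by
  conv_lhs => rw [← directedAt_self, directedAt, treeSection_diag, Function.update_self]

theorem treeSection_directed_of_ne (j : ZMod p) (e : Vec p) {x : ZMod p} (h : x ≠ 1 - j) :
    treeSection (directed j e) [x] = rot (e.extend (x - (1 - j))) := by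
  rw [← directedAt_self, directedAt, treeSection_diag, Function.update_of_ne h]

end Directed

/-! ### Basic properties of multi-EGS groups -/

namespace NumericalDatum

variable {p : ℕ} (E : NumericalDatum p)

/-- The span of the defining vectors of the `j`th family. -/
def familySpan (j : ZMod p) : Submodule (ZMod p) (Vec p) :=
  Submodule.span (ZMod p) (Set.range (E.vec j))

theorem vec_mem_familySpan (j : ZMod p) (i : Fin (E.r j)) : E.vec j i ∈ E.familySpan j :=
  Submodule.subset_span ⟨i, rfl⟩

theorem vec_ne_zero [Nontrivial (ZMod p)] (j : ZMod p) (i : Fin (E.r j)) : E.vec j i ≠ 0 :=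
  (E.linearIndependent j).ne_zero i

theorem exists_vec : ∃ (j : ZMod p) (_ : Fin (E.r j)), True := by
  obtain ⟨j, hj⟩ := E.exists_r_ne_zero
  exact ⟨j, ⟨0, Nat.pos_of_ne_zero hj⟩, trivial⟩

theorem rooted_mem : rooted p ∈ E.group := Subgroup.subset_closure (Or.inl rfl)

theorem directed_vec_mem (j : ZMod p) (i : Fin (E.r j)) : directed j (E.vec j i) ∈ E.group :=
  Subgroup.subset_closure (Or.inr ⟨j, i, rfl⟩)

theorem rot_mem (s : ZMod p) : rot s ∈ E.group := Subgroup.pow_mem _ E.rooted_mem _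

variable [Fact p.Prime]

variable {E}

theorem directed_mem {j : ZMod p} {e : Vec p} (he : e ∈ E.familySpan j) :
    directed j e ∈ E.group := by
  induction he using Submodule.span_induction with
  | mem x hx =>
    obtain ⟨i, rfl⟩ := hx
    exact E.directed_vec_mem j i
  | zero => rw [directed_zero]; exact Subgroup.one_mem _
  | add x y _ _ hx hy => rw [directed_add]; exact Subgroup.mul_mem _ hx hy
  | smul c x _ hx =>
    rw [← ZMod.natCast_zmod_val c, Nat.cast_smul_eq_nsmul, directed_nsmul]
    exact Subgroup.pow_mem _ hx _

theorem directedAt_mem (x : ZMod p) {j : ZMod p} {e : Vec p} (he : e ∈ E.familySpan j) :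
    directedAt x j e ∈ E.group := by
  have h := rot_mul_directedAt_mul_inv (x - (1 - j)) (1 - j) j e
  rw [add_sub_cancel] at h
  rw [← h, directedAt_self]
  exact Subgroup.mul_mem _ (Subgroup.mul_mem _ (E.rot_mem _) (directed_mem he))
    (Subgroup.inv_mem _ (E.rot_mem _))

/-- Induction on the elements of the group, with the generators written as `rot 1` and
`directed j e`. -/
theorem group_induction {P : (g : TreeAut (ZMod p)) → g ∈ E.group → Prop}
    (rot : P (rot 1) (E.rot_mem 1))
    (directed : ∀ j i, P (directed j (E.vec j i)) (E.directed_vec_mem j i))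
    (one : P 1 (Subgroup.one_mem _))
    (mul : ∀ f g hf hg, P f hf → P g hg → P (f * g) (Subgroup.mul_mem _ hf hg))
    (inv : ∀ g hg, P g hg → P g⁻¹ (Subgroup.inv_mem _ hg)) {g : TreeAut (ZMod p)}
    (hg : g ∈ E.group) : P g hg := by
  refine Subgroup.closure_induction (p := P) ?_ one mul inv hg
  rintro _ (h | ⟨j, i, rfl⟩)
  · have h' := h.trans rot_one.symm
    subst h'
    exact rot
  · exact directed j i

theorem treeSection_mem {g : TreeAut (ZMod p)} (hg : g ∈ E.group) (u : List (ZMod p)) :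
    treeSection g u ∈ E.group := by
  have key : ∀ g ∈ E.group, ∀ x, treeSection g [x] ∈ E.group := by
    intro g hg
    induction hg using group_induction with
    | rot => intro x; rw [treeSection_rot]; exact Subgroup.one_mem _
    | directed j i =>
      intro x
      by_cases h : x = 1 - j
      · rw [h, treeSection_directed_self]; exact E.directed_vec_mem j i
      · rw [treeSection_directed_of_ne j _ h]; exact E.rot_mem _
    | one => intro x; rw [treeSection_one]; exact Subgroup.one_mem _
    | mul f g _ _ hf hg' =>
      intro x
      obtain ⟨y, hy⟩ := List.length_eq_one_iff.1 (length_apply g [x])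
      rw [treeSection_mul, hy]
      exact Subgroup.mul_mem _ (hf y) (hg' x)
    | inv g _ hg' =>
      intro x
      obtain ⟨y, hy⟩ := List.length_eq_one_iff.1 (length_apply g⁻¹ [x])
      have h : treeSection (g * g⁻¹) [x] = 1 := by rw [mul_inv_cancel, treeSection_one]
      rw [treeSection_mul, hy] at h
      rw [eq_inv_of_mul_eq_one_right h]
      exact Subgroup.inv_mem _ (hg' y)
  induction u generalizing g with
  | nil => rwa [treeSection_nil]
  | cons x u ih =>
    rw [← List.singleton_append, treeSection_append]
    exact ih (key g hg x)

theorem smul_extend_eq_one {e : Vec p} {d : ZMod p} (hd : e.extend d ≠ 0) :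
    ((e.extend d)⁻¹ • e).extend d = 1 := by
  rw [map_smul, Pi.smul_apply, smul_eq_mul, inv_mul_cancel₀ hd]

theorem exists_extend_ne_zero {e : Vec p} (he : e ≠ 0) : ∃ d, e.extend d ≠ 0 := by
  by_contra! h
  exact he (Vec.extend_injective (by rw [map_zero]; exact funext h))

/-- The group is fractal: every element is the section at a given letter of an element fixing the
first level. -/
theorem exists_diag_mem (x : ZMod p) {g : TreeAut (ZMod p)} (hg : g ∈ E.group) :
    ∃ k : ZMod p → TreeAut (ZMod p), diag k ∈ E.group ∧ k x = g := by
  induction hg using group_induction with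
  | rot =>
    obtain ⟨j, i, -⟩ := E.exists_vec
    obtain ⟨d, hd⟩ := exists_extend_ne_zero (E.vec_ne_zero j i)
    have hd0 : d ≠ 0 := by
      rintro rfl
      exact hd (Vec.extend_zero_apply _)
    refine ⟨_, directedAt_mem (x - d)
      (Submodule.smul_mem _ ((E.vec j i).extend d)⁻¹ (E.vec_mem_familySpan j i)), ?_⟩
    rw [Function.update_of_ne (fun h => hd0 (by linear_combination h)), sub_sub_cancel,
      smul_extend_eq_one hd]
  | directed j i =>
    exact ⟨_, directedAt_mem x (E.vec_mem_familySpan j i), Function.update_self _ _ _⟩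
  | one => exact ⟨1, by rw [map_one]; exact Subgroup.one_mem _, rfl⟩
  | mul f g _ _ hf hg =>
    obtain ⟨k, hk, rfl⟩ := hf
    obtain ⟨l, hl, rfl⟩ := hg
    exact ⟨k * l, by rw [map_mul]; exact Subgroup.mul_mem _ hk hl, rfl⟩
  | inv g _ hg =>
    obtain ⟨k, hk, rfl⟩ := hg
    exact ⟨k⁻¹, by rw [map_inv]; exact Subgroup.inv_mem _ hk, rfl⟩

variable (E)

theorem isSphericallyTransitive : IsSphericallyTransitive E.group := by
  intro u
  induction u with
  | nil =>
    intro v hv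
    refine ⟨1, Subgroup.one_mem _, ?_⟩
    rw [List.eq_nil_of_length_eq_zero hv.symm]
    rfl
  | cons x u ih =>
    intro v hv
    cases v with
    | nil => simp at hv
    | cons y v =>
      obtain ⟨g, hg, rfl⟩ := ih v (by simpa using hv)
      obtain ⟨k, hk, rfl⟩ := exists_diag_mem y hg
      refine ⟨diag k * rot (y - x), Subgroup.mul_mem _ hk (E.rot_mem _), ?_⟩
      change diag k (rot (y - x) (x :: u)) = _
      rw [rot_cons, add_sub_cancel, diag_cons]

theorem isSelfSimilar : IsSelfSimilar E.group := fun u _ hg => treeSection_mem hg.1 u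

theorem finiteIndex_commutator : (⁅E.group, E.group⁆.subgroupOf E.group).FiniteIndex := by
  refine finiteIndex_commutator_of_torsion (n := p) ?_ (Fact.out : p.Prime).pos ?_
  · refine (Set.finite_singleton _).union ?_
    refine (Set.finite_range fun q : (j : ZMod p) × Fin (E.r j) =>
      directed q.1 (E.vec q.1 q.2)).subset ?_
    rintro _ ⟨j, i, rfl⟩
    exact ⟨⟨j, i⟩, rfl⟩
  · rintro _ (h | ⟨j, i, rfl⟩)
    · rw [Set.mem_singleton_iff.1 h]
      have h1 : ∀ n : ℕ, rooted p ^ n = rot (n : ZMod p) := by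
        intro n
        induction n with
        | zero => rw [pow_zero, Nat.cast_zero, rot_zero]
        | succ n ih => rw [pow_succ, Nat.cast_succ, rot_add, ih, rot_one]
      rw [h1, CharP.cast_eq_zero, rot_zero]
    · rw [← directed_nsmul, ← Nat.cast_smul_eq_nsmul (ZMod p), CharP.cast_eq_zero, zero_smul,
        directed_zero]

/-- The elements of the group act on the first level as powers of `a`. -/
theorem exists_apply_singleton {g : TreeAut (ZMod p)} (hg : g ∈ E.group) :
    ∃ s : ZMod p, ∀ x, g [x] = [x + s] := by
  induction hg using group_induction with
  | rot => exact ⟨1, fun x => rot_cons 1 x []⟩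
  | directed j i =>
    refine ⟨0, fun x => ?_⟩
    rw [← directedAt_self, directedAt, diag_singleton, add_zero]
  | one => exact ⟨0, fun x => by rw [add_zero]; rfl⟩
  | mul f g _ _ hf hg =>
    obtain ⟨s, hs⟩ := hf
    obtain ⟨t, ht⟩ := hg
    refine ⟨t + s, fun x => ?_⟩
    change f (g [x]) = _
    rw [ht, hs, add_assoc]
  | inv g _ hg =>
    obtain ⟨s, hs⟩ := hg
    refine ⟨-s, fun x => ?_⟩
    have h : g [x + -s] = [x] := by rw [hs, neg_add_cancel_right]
    rw [← h]
    exact g.symm_apply_apply _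

theorem commutator_le_levelStabilizer : ⁅E.group, E.group⁆ ≤ levelStabilizer E.group 1 := by
  rw [Subgroup.commutator_le]
  intro f hf g hg
  refine mem_levelStabilizer.2
    ⟨commutator_le_self _ (Subgroup.commutator_mem_commutator hf hg), fun u hu => ?_⟩
  obtain ⟨x, rfl⟩ := List.length_eq_one_iff.1 hu
  obtain ⟨s, hs⟩ := E.exists_apply_singleton hf
  obtain ⟨t, ht⟩ := E.exists_apply_singleton hg
  have h : (f * g) [x] = (g * f) [x] := by
    change f (g [x]) = g (f [x])
    rw [hs, ht, hs, ht, add_right_comm]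
  have h2 : ⁅f, g⁆ = (f * g) * (g * f)⁻¹ := by rw [commutatorElement_def]; group
  obtain ⟨s', hs'⟩ := E.exists_apply_singleton (Subgroup.mul_mem _ hg hf)
  have h3 : (f * g) [x - s'] = [x] := by
    change f (g [x - s']) = [x]
    have h4 : f (g [x - s']) = g (f [x - s']) := by rw [hs, ht, hs, ht, add_right_comm]
    rw [h4]
    exact (hs' _).trans (by rw [sub_add_cancel])
  have h5 : (g * f) [x - s'] = [x] := by rw [hs', sub_add_cancel]
  rw [h2]
  change (f * g) ((g * f)⁻¹ [x]) = [x]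
  have h6 : (g * f)⁻¹ [x] = [x - s'] := by
    rw [← h5]
    exact (g * f).symm_apply_apply _
  rw [h6, h3]

theorem commutator_ne_bot : ⁅E.group, E.group⁆ ≠ ⊥ := by
  intro h
  obtain ⟨j, i, -⟩ := E.exists_vec
  obtain ⟨d, hd⟩ := exists_extend_ne_zero (E.vec_ne_zero j i)
  have h1 : ⁅rot (1 : ZMod p), directed j (E.vec j i)⁆ = 1 := by
    rw [← Subgroup.mem_bot, ← h]
    exact Subgroup.commutator_mem_commutator (E.rot_mem 1) (E.directed_vec_mem j i)
  have h2 : directedAt (1 - j + (-d)) j (E.vec j i) = directedAt (1 - j) j (E.vec j i) := by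
    have h3 : Commute (rot (1 : ZMod p)) (directed j (E.vec j i)) :=
      commutatorElement_eq_one_iff_commute.1 h1
    have h4 : Commute (rot (-d)) (directed j (E.vec j i)) := by
      rw [rot, ← rot_one]
      exact h3.pow_left _
    rw [← rot_mul_directedAt_mul_inv, directedAt_self, h4.eq, mul_inv_cancel_right]
  have hd0 : d ≠ 0 := by
    rintro rfl
    exact hd (Vec.extend_zero_apply _)
  have h5 := congrArg (fun g => treeSection g [1 - j] [0]) h2
  simp only [directedAt] at h5
  rw [treeSection_diag, treeSection_diag, Function.update_self,
    Function.update_of_ne (fun h => hd0 (by linear_combination h)), rot_cons] at h5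
  rw [← directedAt_self, directedAt, diag_singleton] at h5
  apply hd
  simpa using h5

end NumericalDatum

/-! ### Commutators invariant under rescaling -/

section Algebra

variable {p : ℕ} [Fact p.Prime] {Q : Type*} [Group Q] {α β φ : ZMod p → Q}

theorem two_ne_zero_of_odd (hp : Odd p) : (2 : ZMod p) ≠ 0 := by
  intro h0
  have h1 : p ∣ 2 := (ZMod.natCast_eq_zero_iff 2 p).1 (by exact_mod_cast h0)
  have h2 := Nat.le_of_dvd two_pos h1
  have h3 := (Fact.out : p.Prime).two_le
  obtain ⟨h, hh⟩ := hp
  omega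

theorem additive_zero (hφ : ∀ s t, φ (s + t) = φ s * φ t) : φ 0 = 1 := by
  have h := hφ 0 0
  rwa [add_zero, left_eq_mul] at h

theorem additive_mul (hφ : ∀ s t, φ (s + t) = φ s * φ t) (s t : ZMod p) :
    φ (t * s) = φ s ^ t.val := by
  have key : ∀ n : ℕ, φ (n * s) = φ s ^ n := by
    intro n
    induction n with
    | zero => rw [Nat.cast_zero, zero_mul, pow_zero, additive_zero hφ]
    | succ n ih => rw [Nat.cast_succ, add_mul, one_mul, hφ, ih, pow_succ]
  rw [← key, ZMod.natCast_zmod_val]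

theorem additive_eq_one (hφ : ∀ s t, φ (s + t) = φ s * φ t) {c : ZMod p} (hc : c ≠ 1)
    (h : ∀ r, φ (c * r) = φ r) (r : ZMod p) : φ r = 1 := by
  have h1 := h (r / (c - 1))
  have h2 : c * (r / (c - 1)) = r + r / (c - 1) := by
    have := sub_ne_zero.2 hc
    field_simp
    ring
  rwa [h2, hφ, mul_eq_right] at h1

/-- If `α m` and `α (c * m)` act in the same way on `x` for all `m`, where `c ≠ 1`, then
`α ((1 - c) * m)` and hence all of `α` centralises `x`. -/
theorem commute_of_conj_eq (hα : ∀ s t, α (s + t) = α s * α t) {c : ZMod p} (hc : c ≠ 1) {x : Q}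
    (h : ∀ m, α m * x * (α m)⁻¹ = α (c * m) * x * (α (c * m))⁻¹) (m : ZMod p) :
    Commute (α m) x := by
  have h1 := h (m / (1 - c))
  have h2 : α (m / (1 - c)) = α (c * (m / (1 - c))) * α m := by
    rw [← hα]
    congr 1
    have := sub_ne_zero.2 hc.symm
    field_simp
    ring
  rw [h2] at h1
  have h3 := congrArg (fun y => (α (c * (m / (1 - c))))⁻¹ * y * α (c * (m / (1 - c)))) h1
  simp only [mul_assoc, mul_inv_rev, inv_mul_cancel_left, inv_mul_cancel, mul_one] at h3
  rwa [← mul_assoc, mul_inv_eq_iff_eq_mul] at h3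

theorem commutator_additive_right (hα : ∀ s t, α (s + t) = α s * α t) {b : Q}
    (h : ∀ m t, Commute (α m) ⁅b, α t⁆) (s t : ZMod p) :
    ⁅b, α (s + t)⁆ = ⁅b, α s⁆ * ⁅b, α t⁆ := by
  have h1 : ⁅b, α (s + t)⁆ = ⁅b, α s⁆ * (α s * ⁅b, α t⁆ * (α s)⁻¹) := by
    rw [hα]
    simp only [commutatorElement_def]
    group
  rw [h1, (h s t).eq, mul_inv_cancel_right]

theorem commutator_additive_left (hβ : ∀ s t, β (s + t) = β s * β t) {a : Q}
    (h : ∀ m s, Commute (β m) ⁅β s, a⁆) (s t : ZMod p) :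
    ⁅β (s + t), a⁆ = ⁅β s, a⁆ * ⁅β t, a⁆ := by
  have h1 : ⁅β (t + s), a⁆ = (β t * ⁅β s, a⁆ * (β t)⁻¹) * ⁅β t, a⁆ := by
    rw [hβ]
    simp only [commutatorElement_def]
    group
  rw [add_comm, h1, (h t s).eq, mul_inv_cancel_right]

/-- If the commutators `⁅β s, α t⁆` are additive in both variables, they only depend on `s * t`. -/
theorem commutator_eq_of_biadditive
    (h1 : ∀ b s t, ⁅β b, α (s + t)⁆ = ⁅β b, α s⁆ * ⁅β b, α t⁆)
    (h2 : ∀ a s t, ⁅β (s + t), α a⁆ = ⁅β s, α a⁆ * ⁅β t, α a⁆) (s t : ZMod p) :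
    ⁅β s, α t⁆ = ⁅β (t * s), α 1⁆ := by
  have h3 := additive_mul (φ := fun t => ⁅β s, α t⁆) (h1 s) 1 t
  have h4 := additive_mul (φ := fun s => ⁅β s, α 1⁆) (h2 1) s t
  simp only [mul_one] at h3
  exact h3.trans h4.symm

/-- Two cyclic groups of order `p` commute if rescaling their parameters by `κ` and `μ` with
`κ * μ ≠ 1` does not change the commutators, nor their conjugates by the two groups. -/
theorem commutator_eq_one_of_rescaling (hα : ∀ s t, α (s + t) = α s * α t)
    (hβ : ∀ s t, β (s + t) = β s * β t) {κ μ : ZMod p} (hκμ : κ * μ ≠ 1)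
    (Hα : ∀ s t m, α m * ⁅β s, α t⁆ * (α m)⁻¹ =
      α (μ * m) * ⁅β (κ * s), α (μ * t)⁆ * (α (μ * m))⁻¹)
    (Hβ : ∀ s t m, β m * ⁅β s, α t⁆ * (β m)⁻¹ =
      β (κ * m) * ⁅β (κ * s), α (μ * t)⁆ * (β (κ * m))⁻¹)
    (s t : ZMod p) : ⁅β s, α t⁆ = 1 := by
  have H : ∀ s t, ⁅β (κ * s), α (μ * t)⁆ = ⁅β s, α t⁆ := by
    intro s t
    have h := Hα s t 0
    rw [mul_zero, additive_zero hα, inv_one, one_mul, mul_one, one_mul, mul_one] at h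
    exact h.symm
  have h1 : μ ≠ 1 → ∀ b s t, ⁅β b, α (s + t)⁆ = ⁅β b, α s⁆ * ⁅β b, α t⁆ := fun hμ b =>
    commutator_additive_right hα fun m t =>
      commute_of_conj_eq hα hμ (fun m => by rw [Hα, H]) m
  have h2 : κ ≠ 1 → ∀ a s t, ⁅β (s + t), α a⁆ = ⁅β s, α a⁆ * ⁅β t, α a⁆ := fun hκ a =>
    commutator_additive_left hβ fun m s =>
      commute_of_conj_eq hβ hκ (fun m => by rw [Hβ, H]) m
  by_cases hμ : μ = 1
  · subst hμ
    rw [mul_one] at hκμ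
    exact additive_eq_one (φ := fun s => ⁅β s, α t⁆) (h2 hκμ t) hκμ
      (fun r => by simpa only [one_mul] using H r t) s
  by_cases hκ : κ = 1
  · subst hκ
    exact additive_eq_one (φ := fun t => ⁅β s, α t⁆) (h1 hμ s) hμ
      (fun r => by simpa only [one_mul] using H s r) t
  have h3 := commutator_eq_of_biadditive (h1 hμ) (h2 hκ)
  rw [h3]
  refine additive_eq_one (φ := fun s => ⁅β s, α 1⁆) (h2 hκ 1) hκμ (fun r => ?_) _
  have h4 := H r 1
  rw [h3, mul_one] at h4
  rw [← h4, ← mul_assoc, mul_comm μ]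

/-- The variant of `commutator_eq_one_of_rescaling` in which both parameters are rescaled by the
same `q ≠ 1`. This does not suffice if `q = -1`, and the additional symmetry exchanges the roles
of the two groups. -/
theorem commutator_eq_one_of_swap (hα : ∀ s t, α (s + t) = α s * α t)
    (hβ : ∀ s t, β (s + t) = β s * β t) {q : ZMod p} (hq : q ≠ 1)
    (Hα : ∀ s t m, α m * ⁅β s, α t⁆ * (α m)⁻¹ =
      α (q * m) * ⁅β (q * s), α (q * t)⁆ * (α (q * m))⁻¹)
    (Hβ : ∀ s t m, β m * ⁅β s, α t⁆ * (β m)⁻¹ =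
      β (q * m) * ⁅β (q * s), α (q * t)⁆ * (β (q * m))⁻¹)
    {μ ν : ZMod p} (hμν : μ * ν ≠ 1) (H' : ∀ s t, ⁅β s, α t⁆ = ⁅β (μ * t), α (ν * s)⁆)
    (s t : ZMod p) : ⁅β s, α t⁆ = 1 := by
  have H : ∀ s t, ⁅β (q * s), α (q * t)⁆ = ⁅β s, α t⁆ := by
    intro s t
    have h := Hα s t 0
    rw [mul_zero, additive_zero hα, inv_one, one_mul, mul_one, one_mul, mul_one] at h
    exact h.symm
  have h1 : ∀ b s t, ⁅β b, α (s + t)⁆ = ⁅β b, α s⁆ * ⁅β b, α t⁆ := fun b =>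
    commutator_additive_right hα fun m t =>
      commute_of_conj_eq hα hq (fun m => by rw [Hα, H]) m
  have h2 : ∀ a s t, ⁅β (s + t), α a⁆ = ⁅β s, α a⁆ * ⁅β t, α a⁆ := fun a =>
    commutator_additive_left hβ fun m s =>
      commute_of_conj_eq hβ hq (fun m => by rw [Hβ, H]) m
  have h3 := commutator_eq_of_biadditive h1 h2
  rw [h3]
  refine additive_eq_one (φ := fun s => ⁅β s, α 1⁆) (h2 1) hμν (fun r => ?_) _
  have h4 := H' r 1
  rw [h3, h3 (μ * 1), one_mul] at h4
  rw [h4]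
  congr 2
  ring

end Algebra

/-! ### Moving commutators between letters -/

namespace NumericalDatum

variable {p : ℕ} (E : NumericalDatum p)

/-- The elements `k` for which the automorphism acting as `k` on the subtree at the letter `0`, and
trivially elsewhere, lies in the derived subgroup. -/
def localCommutator : Subgroup (TreeAut (ZMod p)) := ⁅E.group, E.group⁆.comap (atLetter 0)

/-- The elements `k` and `l`, placed on the subtrees at the letters `x` and `y`, agree modulo the
derived subgroup. -/
def Linked (x : ZMod p) (k : TreeAut (ZMod p)) (y : ZMod p) (l : TreeAut (ZMod p)) : Prop :=
  atLetter x k * (atLetter y l)⁻¹ ∈ ⁅E.group, E.group⁆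

variable {E} {x y z d j j' s t m : ZMod p} {k l k' : TreeAut (ZMod p)} {e e' : Vec p}

namespace Linked

theorem symm (h : E.Linked x k y l) : E.Linked y l x k := by
  have h' := Subgroup.inv_mem _ h
  rwa [mul_inv_rev, inv_inv] at h'

theorem trans (h : E.Linked x k y l) (h' : E.Linked y l z k') : E.Linked x k z k' := by
  have h2 := Subgroup.mul_mem _ h h'
  rwa [mul_assoc, inv_mul_cancel_left] at h2

theorem refl : E.Linked x k x k := by
  rw [Linked, mul_inv_cancel]
  exact Subgroup.one_mem _

theorem conj {g : ZMod p → TreeAut (ZMod p)} (hg : diag g ∈ E.group) (h : E.Linked x k y l) :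
    E.Linked x (g x * k * (g x)⁻¹) y (g y * l * (g y)⁻¹) := by
  have h1 := conj_mem_commutator hg h
  rw [Linked, ← diag_mul_atLetter_mul_inv, ← diag_mul_atLetter_mul_inv]
  convert h1 using 1
  group

theorem sub_ne (hd : d ≠ 0) (x : ZMod p) : x - d ≠ x := fun h => hd (by linear_combination -h)

end Linked

variable [Fact p.Prime]

theorem atLetter_mem_iff : atLetter x k ∈ ⁅E.group, E.group⁆ ↔ k ∈ E.localCommutator := by
  have key : ∀ x s, atLetter x k ∈ ⁅E.group, E.group⁆ →
      atLetter (x + s) k ∈ ⁅E.group, E.group⁆ := fun x s h => by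
    rw [← rot_mul_atLetter_mul_inv]
    exact conj_mem_commutator (E.rot_mem s) h
  constructor
  · intro h
    have h' := key x (-x) h
    rwa [add_neg_cancel] at h'
  · intro h
    have h' := key 0 x h
    rwa [zero_add] at h'

theorem conj_mem_localCommutator (hl : l ∈ E.group) (hk : k ∈ E.localCommutator) :
    l * k * l⁻¹ ∈ E.localCommutator := by
  obtain ⟨g, hg, rfl⟩ := exists_diag_mem 0 hl
  have h := conj_mem_commutator hg hk
  rwa [diag_mul_atLetter_mul_inv] at h

namespace Linked

theorem mul_inv_mem (h : E.Linked x k x l) : k * l⁻¹ ∈ E.localCommutator := by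
  rw [Linked, ← map_inv, ← map_mul] at h
  exact atLetter_mem_iff.1 h

theorem mem (h : E.Linked x k y l) (hk : k ∈ E.localCommutator) : l ∈ E.localCommutator := by
  have h1 := Subgroup.mul_mem _ (Subgroup.inv_mem _ h) ((atLetter_mem_iff (x := x)).2 hk)
  rw [mul_inv_rev, inv_inv, inv_mul_cancel_right] at h1
  exact atLetter_mem_iff.1 h1

theorem conj_left (hd : d ≠ 0) (he : e ∈ E.familySpan j) (h : E.Linked x k (x - d) l) :
    E.Linked x (directed j e * k * (directed j e)⁻¹) (x - d)
      (rot (e.extend (-d)) * l * (rot (e.extend (-d)))⁻¹) := by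
  have h1 := h.conj (directedAt_mem x he)
  rwa [Function.update_self, Function.update_of_ne (sub_ne hd x), sub_sub_cancel_left] at h1

theorem conj_right (hd : d ≠ 0) (he : e ∈ E.familySpan j) (h : E.Linked x k (x - d) l) :
    E.Linked x (rot (e.extend d) * k * (rot (e.extend d))⁻¹) (x - d)
      (directed j e * l * (directed j e)⁻¹) := by
  have h1 := h.conj (directedAt_mem (x - d) he)
  rwa [Function.update_self, Function.update_of_ne (sub_ne hd x).symm, sub_sub_cancel] at h1

end Linked

/-- The basic relation: the commutator of two directed elements with different distinguished
letters is supported on these two letters. -/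
theorem linked_commutator (hd : d ≠ 0) (he : e ∈ E.familySpan j) (he' : e' ∈ E.familySpan j')
    (x : ZMod p) :
    E.Linked x ⁅directed j e, rot (e'.extend d)⁆ (x - d) ⁅directed j' e', rot (e.extend (-d))⁆ := by
  have h := Subgroup.commutator_mem_commutator (directedAt_mem x he) (directedAt_mem (x - d) he')
  rw [Linked]
  convert h using 1
  rw [directedAt, directedAt, ← map_commutatorElement, atLetter_eq, atLetter_eq, ← map_inv,
    ← map_mul]
  congr 1
  funext y
  have hx := Linked.sub_ne hd x
  by_cases h1 : y = x
  · subst h1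
    simp [commutatorElement_def, Function.update_of_ne hx.symm, Pi.mulSingle_eq_of_ne hx.symm]
  · by_cases h2 : y = x - d
    · subst h2
      simp only [commutatorElement_def, Pi.mul_apply, Pi.inv_apply, Pi.mulSingle_eq_same,
        Function.update_self, Pi.mulSingle_eq_of_ne hx, Function.update_of_ne hx,
        sub_sub_cancel_left]
      group
    · simp only [Pi.mul_apply, Pi.inv_apply, Pi.mulSingle_eq_of_ne h1, Pi.mulSingle_eq_of_ne h2,
        commutatorElement_def, Function.update_of_ne h1, Function.update_of_ne h2]
      rw [(rot_commute _ _).eq]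
      group

theorem commutator_directed_mem (he : e ∈ E.familySpan j) (he' : e' ∈ E.familySpan j') :
    ⁅directed j e, directed j' e'⁆ ∈ E.localCommutator := by
  have h := Subgroup.commutator_mem_commutator (directedAt_mem 0 he) (directedAt_mem 0 he')
  rw [directedAt, directedAt, ← map_commutatorElement] at h
  change atLetter 0 ⁅directed j e, directed j' e'⁆ ∈ ⁅E.group, E.group⁆
  convert h using 1
  rw [atLetter_eq]
  congr 1
  funext y
  by_cases h1 : y = 0
  · subst h1
    simp [commutatorElement_def]
  · simp only [Pi.mulSingle_eq_of_ne h1, commutatorElement_def, Function.update_of_ne h1,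
      Pi.mul_apply, Pi.inv_apply]
    rw [(rot_commute _ _).eq]
    group

instance normal_localCommutator : (E.localCommutator.subgroupOf E.group).Normal :=
  ⟨fun _ hk g => conj_mem_localCommutator g.2 hk⟩

variable (E) in
/-- The quotient of the group by the elements of `localCommutator`. -/
abbrev LocalQuotient : Type := E.group ⧸ E.localCommutator.subgroupOf E.group

variable (E) in
/-- The image of `a ^ s` in the quotient. -/
def rotBar (s : ZMod p) : E.LocalQuotient := QuotientGroup.mk' _ ⟨rot s, E.rot_mem s⟩

/-- The image of a directed element in the quotient. -/
def directedBar (he : e ∈ E.familySpan j) : E.LocalQuotient :=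
  QuotientGroup.mk' _ ⟨directed j e, directed_mem he⟩

theorem rotBar_add (s t : ZMod p) : E.rotBar (s + t) = E.rotBar s * E.rotBar t := by
  rw [rotBar, rotBar, rotBar, ← map_mul]
  exact congrArg _ (Subtype.ext (rot_add s t))

theorem directedBar_smul_add (he : e ∈ E.familySpan j) (s t : ZMod p) :
    directedBar (Submodule.smul_mem _ (s + t) he) =
      directedBar (Submodule.smul_mem _ s he) * directedBar (Submodule.smul_mem _ t he) := by
  rw [directedBar, directedBar, directedBar, ← map_mul]
  refine congrArg _ (Subtype.ext ?_)
  change directed j ((s + t) • e) = directed j (s • e) * directed j (t • e)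
  rw [add_smul, directed_add]

theorem mk_eq_mk {g h : E.group}
    (H : (g : TreeAut (ZMod p)) * (h : TreeAut (ZMod p))⁻¹ ∈ E.localCommutator) :
    (QuotientGroup.mk' (E.localCommutator.subgroupOf E.group) g) = QuotientGroup.mk' _ h := by
  refine (QuotientGroup.eq_iff_div_mem).2 ?_
  rw [div_eq_mul_inv]
  exact H

theorem commute_bar_iff (he : e ∈ E.familySpan j) :
    Commute (directedBar he) (E.rotBar t) ↔ ⁅directed j e, rot t⁆ ∈ E.localCommutator := by
  rw [← commutatorElement_eq_one_iff_commute, directedBar, rotBar, ← map_commutatorElement,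
    QuotientGroup.mk'_apply, QuotientGroup.eq_one_iff]
  rfl

/-- As soon as one commutator of `a` with a non-trivial directed element can be placed on a single
subtree, the whole derived subgroup can. -/
theorem commutator_le_localCommutator (he : e ∈ E.familySpan j) (he0 : e ≠ 0) (ht : t ≠ 0)
    (h : ⁅directed j e, rot t⁆ ∈ E.localCommutator) :
    ⁅E.group, E.group⁆ ≤ E.localCommutator := by
  have hall : ∀ {j e} (he : e ∈ E.familySpan j) {t : ZMod p}, t ≠ 0 →
      ⁅directed j e, rot t⁆ ∈ E.localCommutator → ∀ s, Commute (directedBar he) (E.rotBar s) := by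
    intro j e he t ht h s
    have h1 := (commute_bar_iff he).2 h
    rw [← div_mul_cancel₀ s ht, additive_mul rotBar_add]
    exact h1.pow_right _
  have hdr : ∀ {j' e'} (he' : e' ∈ E.familySpan j') (s),
      Commute (directedBar he') (E.rotBar s) := by
    intro j' e' he'
    obtain ⟨d, hd⟩ := exists_extend_ne_zero he0
    have hd0 : -d ≠ 0 := by
      refine neg_ne_zero.2 ?_
      rintro rfl
      exact hd (Vec.extend_zero_apply _)
    have h1 := linked_commutator hd0 he he' 0
    rw [neg_neg] at h1
    exact hall he' hd (h1.mem ((commute_bar_iff he).1 (hall he ht h _)))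
  have hdd : ∀ {j e j' e'} (he : e ∈ E.familySpan j) (he' : e' ∈ E.familySpan j'),
      Commute (directedBar he) (directedBar he') := by
    intro j e j' e' he he'
    rw [← commutatorElement_eq_one_iff_commute, directedBar, directedBar, ← map_commutatorElement,
      QuotientGroup.mk'_apply, QuotientGroup.eq_one_iff]
    exact commutator_directed_mem he he'
  have hrr : ∀ s t, Commute (E.rotBar s) (E.rotBar t) := fun s t => by
    rw [Commute, SemiconjBy, ← rotBar_add, ← rotBar_add, add_comm]
  let π := QuotientGroup.mk' (E.localCommutator.subgroupOf E.group)
  have ext : ∀ q : E.LocalQuotient, Commute (E.rotBar 1) q →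
      (∀ j i, Commute (directedBar (E.vec_mem_familySpan j i)) q) →
      ∀ g (hg : g ∈ E.group), Commute (π ⟨g, hg⟩) q := by
    intro q h1 h2 g hg
    induction hg using group_induction with
    | rot => exact h1
    | directed j i => exact h2 j i
    | one => exact (map_one π).symm ▸ Commute.one_left q
    | mul f g hf hg ihf ihg => exact (map_mul π ⟨f, hf⟩ ⟨g, hg⟩).symm ▸ ihf.mul_left ihg
    | inv g hg ih => exact (map_inv π ⟨g, hg⟩).symm ▸ ih.inv_left
  rw [Subgroup.commutator_le]
  intro f hf g hg
  have hfg : Commute (π ⟨f, hf⟩) (π ⟨g, hg⟩) := by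
    refine ext _ (ext _ (hrr 1 1) (fun j i => hdr _ 1) g hg).symm
      (fun j i => (ext _ (hdr _ 1).symm (fun j' i' => hdd _ _) g hg).symm) f hf
  rw [← commutatorElement_eq_one_iff_commute, ← map_commutatorElement,
    QuotientGroup.mk'_apply, QuotientGroup.eq_one_iff] at hfg
  exact hfg

/-- One step of moving commutators, conjugated by powers of `a`, to another letter. It exchanges
the roles of `a` and the directed elements. -/
theorem linked_step_rot (hd : d ≠ 0) (he : e ∈ E.familySpan j) (he' : e' ∈ E.familySpan j')
    (hu : e'.extend d ≠ 0) (x s t m : ZMod p) :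
    E.Linked x (rot m * ⁅directed j (s • e), rot t⁆ * (rot m)⁻¹) (x - d)
      (directed j' ((m / e'.extend d) • e') *
        ⁅directed j' ((t / e'.extend d) • e'), rot (e.extend (-d) * s)⁆ *
        (directed j' ((m / e'.extend d) • e'))⁻¹) := by
  have h1 := linked_commutator hd (Submodule.smul_mem _ s he)
    (Submodule.smul_mem _ (t / e'.extend d) he') x
  have h2 := h1.conj_right hd (Submodule.smul_mem _ (m / e'.extend d) he')
  simp only [map_smul, Pi.smul_apply, smul_eq_mul, div_mul_cancel₀ _ hu] at h2
  rwa [mul_comm s] at h2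

/-- One step of moving commutators, conjugated by directed elements, to another letter. -/
theorem linked_step_directed (hd : d ≠ 0) (he : e ∈ E.familySpan j) (he' : e' ∈ E.familySpan j')
    (hu : e'.extend d ≠ 0) (x s t m : ZMod p) :
    E.Linked x (directed j (m • e) * ⁅directed j (s • e), rot t⁆ * (directed j (m • e))⁻¹) (x - d)
      (rot (e.extend (-d) * m) *
        ⁅directed j' ((t / e'.extend d) • e'), rot (e.extend (-d) * s)⁆ *
        (rot (e.extend (-d) * m))⁻¹) := by
  have h1 := linked_commutator hd (Submodule.smul_mem _ s he)
    (Submodule.smul_mem _ (t / e'.extend d) he') x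
  have h2 := h1.conj_left hd (Submodule.smul_mem _ m he)
  simp only [map_smul, Pi.smul_apply, smul_eq_mul, div_mul_cancel₀ _ hu] at h2
  rwa [mul_comm s, mul_comm m] at h2

/-- Two steps return to commutators of the same kind, with rescaled parameters. -/
theorem linked_iterate_rot (hd : d ≠ 0) (he : e ∈ E.familySpan j) (he' : e' ∈ E.familySpan j')
    (hu : e.extend d ≠ 0) (hu' : e'.extend d ≠ 0) (x s t m : ZMod p) (n : ℕ) :
    E.Linked x (rot m * ⁅directed j (s • e), rot t⁆ * (rot m)⁻¹) (x - n * (2 * d))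
      (rot ((e'.extend (-d) / e'.extend d) ^ n * m) *
        ⁅directed j (((e.extend (-d) / e.extend d) ^ n * s) • e),
          rot ((e'.extend (-d) / e'.extend d) ^ n * t)⁆ *
        (rot ((e'.extend (-d) / e'.extend d) ^ n * m))⁻¹) := by
  induction n with
  | zero => simpa using Linked.refl
  | succ n ih =>
    have hx : x - n * (2 * d) - d - d = x - (n + 1 : ℕ) * (2 * d) := by push_cast; ring
    have hκ : ∀ c, e.extend (-d) * ((e.extend (-d) / e.extend d) ^ n * c) / e.extend d =
        (e.extend (-d) / e.extend d) ^ (n + 1) * c := fun c => by rw [pow_succ]; ring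
    have hμ : ∀ c, e'.extend (-d) * ((e'.extend (-d) / e'.extend d) ^ n * c / e'.extend d) =
        (e'.extend (-d) / e'.extend d) ^ (n + 1) * c := fun c => by rw [pow_succ]; ring
    refine ih.trans ?_
    have h := (linked_step_rot hd he he' hu' (x - n * (2 * d))
      ((e.extend (-d) / e.extend d) ^ n * s) ((e'.extend (-d) / e'.extend d) ^ n * t)
      ((e'.extend (-d) / e'.extend d) ^ n * m)).trans (linked_step_directed hd he' he hu _ _ _ _)
    simp only [hx, hκ, hμ] at h
    exact h

/-- The analogue of `linked_iterate_rot` for conjugates by directed elements. -/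
theorem linked_iterate_directed (hd : d ≠ 0) (he : e ∈ E.familySpan j)
    (he' : e' ∈ E.familySpan j') (hu : e.extend d ≠ 0) (hu' : e'.extend d ≠ 0)
    (x s t m : ZMod p) (n : ℕ) :
    E.Linked x (directed j (m • e) * ⁅directed j (s • e), rot t⁆ * (directed j (m • e))⁻¹)
      (x - n * (2 * d))
      (directed j (((e.extend (-d) / e.extend d) ^ n * m) • e) *
        ⁅directed j (((e.extend (-d) / e.extend d) ^ n * s) • e),
          rot ((e'.extend (-d) / e'.extend d) ^ n * t)⁆ *
        (directed j (((e.extend (-d) / e.extend d) ^ n * m) • e))⁻¹) := by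
  induction n with
  | zero => simpa using Linked.refl
  | succ n ih =>
    have hx : x - n * (2 * d) - d - d = x - (n + 1 : ℕ) * (2 * d) := by push_cast; ring
    have hκ : ∀ c, e.extend (-d) * ((e.extend (-d) / e.extend d) ^ n * c) / e.extend d =
        (e.extend (-d) / e.extend d) ^ (n + 1) * c := fun c => by rw [pow_succ]; ring
    have hμ : ∀ c, e'.extend (-d) * ((e'.extend (-d) / e'.extend d) ^ n * c / e'.extend d) =
        (e'.extend (-d) / e'.extend d) ^ (n + 1) * c := fun c => by rw [pow_succ]; ring
    refine ih.trans ?_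
    have h := (linked_step_directed hd he he' hu' (x - n * (2 * d))
      ((e.extend (-d) / e.extend d) ^ n * s) ((e'.extend (-d) / e'.extend d) ^ n * t)
      ((e.extend (-d) / e.extend d) ^ n * m)).trans (linked_step_rot hd he' he hu _ _ _ _)
    simp only [hx, hκ, hμ] at h
    exact h

theorem conj_rotBar_eq (he : e ∈ E.familySpan j) {s t m s' t' m' : ZMod p}
    (h : E.Linked x (rot m * ⁅directed j (s • e), rot t⁆ * (rot m)⁻¹) x
      (rot m' * ⁅directed j (s' • e), rot t'⁆ * (rot m')⁻¹)) :
    E.rotBar m * ⁅directedBar (Submodule.smul_mem _ s he), E.rotBar t⁆ * (E.rotBar m)⁻¹ =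
      E.rotBar m' * ⁅directedBar (Submodule.smul_mem _ s' he), E.rotBar t'⁆ * (E.rotBar m')⁻¹ := by
  simp only [rotBar, directedBar, ← map_commutatorElement, ← map_mul, ← map_inv]
  exact mk_eq_mk h.mul_inv_mem

theorem conj_directedBar_eq (he : e ∈ E.familySpan j) {s t m s' t' m' : ZMod p}
    (h : E.Linked x (directed j (m • e) * ⁅directed j (s • e), rot t⁆ * (directed j (m • e))⁻¹) x
      (directed j (m' • e) * ⁅directed j (s' • e), rot t'⁆ * (directed j (m' • e))⁻¹)) :
    directedBar (Submodule.smul_mem _ m he) *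
        ⁅directedBar (Submodule.smul_mem _ s he), E.rotBar t⁆ *
        (directedBar (Submodule.smul_mem _ m he))⁻¹ =
      directedBar (Submodule.smul_mem _ m' he) *
        ⁅directedBar (Submodule.smul_mem _ s' he), E.rotBar t'⁆ *
        (directedBar (Submodule.smul_mem _ m' he))⁻¹ := by
  simp only [rotBar, directedBar, ← map_commutatorElement, ← map_mul, ← map_inv]
  exact mk_eq_mk h.mul_inv_mem

/-- If `⁅β s, α t⁆ = 1` for all parameters, then `directed j e` commutes with `a` modulo
`localCommutator`. -/
theorem commutator_le_of_bar_eq_one (he : e ∈ E.familySpan j) (he0 : e ≠ 0)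
    (h : ∀ s t, ⁅directedBar (Submodule.smul_mem _ s he), E.rotBar t⁆ = 1) :
    ⁅E.group, E.group⁆ ≤ E.localCommutator := by
  have h1 := commutatorElement_eq_one_iff_commute.1 (h 1 1)
  rw [commute_bar_iff, one_smul] at h1
  exact commutator_le_localCommutator he he0 one_ne_zero h1

/-- For a non-symmetric vector `e`, put `q = e_{-d} / e_d ≠ 1`. If `e_d` or `e_{-d}` vanishes, one
of the sections of a basic commutator is trivial. Otherwise `2p` steps lead back to the initial
letter and rescale all parameters by `q ^ p = q`, while `p` steps lead back with exchanged roles. -/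
theorem commutator_le_of_nonsymmetric (hp : Odd p) (he : e ∈ E.familySpan j)
    (hns : ¬ e.IsSymmetric) : ⁅E.group, E.group⁆ ≤ E.localCommutator := by
  have hns' : ∃ d, e.extend (-d) ≠ e.extend d := by
    by_contra! h
    exact hns (e.isSymmetric_iff.2 h)
  obtain ⟨d, hd⟩ := hns'
  have hd0 : d ≠ 0 := by
    rintro rfl
    exact hd (by rw [neg_zero])
  have he0 : e ≠ 0 := by
    rintro rfl
    exact hd (by rw [map_zero]; rfl)
  by_cases hu : e.extend d = 0
  · have h := linked_commutator hd0 he he 0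
    rw [hu, rot_zero, commutatorElement_one_right] at h
    exact commutator_le_localCommutator he he0 (by rwa [hu] at hd) (h.mem (Subgroup.one_mem _))
  by_cases hw : e.extend (-d) = 0
  · have h := linked_commutator (neg_ne_zero.2 hd0) he he 0
    rw [hw, neg_neg, rot_zero, commutatorElement_one_right] at h
    exact commutator_le_localCommutator he he0 hu (h.mem (Subgroup.one_mem _))
  obtain ⟨h, hh⟩ := hp
  set q := e.extend (-d) / e.extend d with hq
  have hq1 : q ≠ 1 := by rwa [hq, ne_eq, div_eq_one_iff_eq hu]
  have hqp : q ^ p = q := ZMod.pow_card q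
  have hpp : ∀ x : ZMod p, x - (p : ℕ) * (2 * d) = x := by
    intro x
    rw [CharP.cast_eq_zero, zero_mul, sub_zero]
  refine commutator_le_of_bar_eq_one he he0
    (commutator_eq_one_of_swap (β := fun s => directedBar (Submodule.smul_mem _ s he))
      (μ := q ^ h / e.extend d) (ν := e.extend (-d) * q ^ h) rotBar_add
      (directedBar_smul_add he) hq1 ?_ ?_ ?_ ?_)
  · intro s t m
    have h1 := linked_iterate_rot hd0 he he hu hu 0 s t m p
    rw [hpp, ← hq, hqp] at h1
    exact conj_rotBar_eq he h1
  · intro s t m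
    have h1 := linked_iterate_directed hd0 he he hu hu 0 s t m p
    rw [hpp, ← hq, hqp] at h1
    exact conj_directedBar_eq he h1
  · have h1 : q ^ h / e.extend d * (e.extend (-d) * q ^ h) = q := by
      calc q ^ h / e.extend d * (e.extend (-d) * q ^ h)
          = q ^ (2 * h + 1) := by rw [pow_succ, two_mul, pow_add, hq]; ring
        _ = q := by rw [← hh, hqp]
    rwa [h1]
  · intro s t
    -- An odd number of steps, namely `p`, returns to the initial letter with the roles exchanged.
    have h1 := (linked_iterate_rot hd0 he he hu hu 0 s t 0 h).trans
      (linked_step_rot hd0 he he hu _ _ _ _)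
    have h2 : (0 : ZMod p) - h * (2 * d) - d = 0 := by
      have h3 : ((2 * h + 1 : ℕ) : ZMod p) = 0 := by rw [← hh, CharP.cast_eq_zero]
      push_cast at h3
      linear_combination -d * h3
    rw [h2, ← hq] at h1
    simp only [mul_zero, zero_div, zero_smul, rot_zero, directed_zero, one_mul, inv_one,
      mul_one] at h1
    have h4 := conj_rotBar_eq (m := 0) (m' := 0) he (x := 0) (s := s) (t := t)
      (s' := q ^ h / e.extend d * t) (t' := e.extend (-d) * q ^ h * s) (by
        simpa only [rot_zero, one_mul, inv_one, mul_one, div_mul_eq_mul_div, mul_assoc] using h1)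
    simpa only [additive_zero rotBar_add, one_mul, inv_one, mul_one] using h4

/-- For linearly independent symmetric vectors with equal supports, a step from `e` to `e'` by `d`
scales the parameters by `e_d` and `1 / e'_d`. Comparing two values of `d` with different ratios
`e_d / e'_d` gives a non-trivial rescaling. -/
theorem commutator_le_of_symmetric (hp : Odd p) (he : e ∈ E.familySpan j)
    (he' : e' ∈ E.familySpan j') (hs : e.IsSymmetric) (hs' : e'.IsSymmetric)
    (he0 : e ≠ 0) (hind : ∀ c : ZMod p, c • e ≠ e') :
    ⁅E.group, E.group⁆ ≤ E.localCommutator := by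
  have he0' : e' ≠ 0 := fun h => hind 0 (by rw [zero_smul, h])
  rw [Vec.isSymmetric_iff] at hs hs'
  have hdne : ∀ {f : Vec p} {d}, f.extend d ≠ 0 → d ≠ 0 := by
    rintro f d h rfl
    exact h (Vec.extend_zero_apply _)
  by_cases hsupp : ∃ d, (e.extend d ≠ 0 ∧ e'.extend d = 0)
  · obtain ⟨d, hd, hd'⟩ := hsupp
    have h := linked_commutator (hdne hd) he he' 0
    rw [hs, hd', rot_zero, commutatorElement_one_right] at h
    exact commutator_le_localCommutator he' he0' hd (h.mem (Subgroup.one_mem _))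
  by_cases hsupp' : ∃ d, (e'.extend d ≠ 0 ∧ e.extend d = 0)
  · obtain ⟨d, hd, hd'⟩ := hsupp'
    have h := linked_commutator (hdne hd) he' he 0
    rw [hs', hd', rot_zero, commutatorElement_one_right] at h
    exact commutator_le_localCommutator he he0 hd (h.mem (Subgroup.one_mem _))
  push Not at hsupp hsupp'
  obtain ⟨d₁, hd₁⟩ := exists_extend_ne_zero he0
  have hd₁' := hsupp d₁ hd₁
  -- Otherwise all ratios `e'_d / e_d` on the common support agree and `e'` is a multiple of `e`.
  obtain ⟨d₂, hd₂, hdet⟩ : ∃ d₂, e.extend d₂ ≠ 0 ∧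
      e'.extend d₁ / e'.extend d₂ * (e.extend d₂ / e.extend d₁) ≠ 1 := by
    by_contra! h
    refine hind (e'.extend d₁ / e.extend d₁) (Vec.extend_injective ?_)
    funext k
    rw [map_smul, Pi.smul_apply, smul_eq_mul]
    by_cases hk : e.extend k = 0
    · rw [hk, mul_zero]
      by_contra hk'
      exact hsupp' k (Ne.symm hk') hk
    · have h1 := h k hk
      have h2 := hsupp k hk
      field_simp at h1 ⊢
      linear_combination h1
  have hd₂' := hsupp d₂ hd₂
  have hd₁0 := hdne hd₁
  have h2 := two_ne_zero_of_odd hp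
  -- As `e` and `e'` are symmetric, two steps do not change the parameters, so that every letter
  -- can be reached without changing them.
  have hn : ∀ x y : ZMod p, x - (((x - y) / (2 * d₁)).val : ℕ) * (2 * d₁) = y := by
    intro x y
    rw [ZMod.natCast_zmod_val, div_mul_cancel₀ _ (mul_ne_zero h2 hd₁0), sub_sub_cancel]
  have hrot : ∀ x y s t m : ZMod p, E.Linked x (rot m * ⁅directed j (s • e), rot t⁆ * (rot m)⁻¹) y
      (rot m * ⁅directed j (s • e), rot t⁆ * (rot m)⁻¹) := by
    intro x y s t m
    have h1 := linked_iterate_rot hd₁0 he he' hd₁ hd₁' x s t m ((x - y) / (2 * d₁)).val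
    rw [hn, hs, hs', div_self hd₁, div_self hd₁', one_pow, one_mul, one_mul, one_mul] at h1
    exact h1
  have hdir : ∀ x y s t m : ZMod p, E.Linked x
      (directed j (m • e) * ⁅directed j (s • e), rot t⁆ * (directed j (m • e))⁻¹) y
      (directed j (m • e) * ⁅directed j (s • e), rot t⁆ * (directed j (m • e))⁻¹) := by
    intro x y s t m
    have h1 := linked_iterate_directed hd₁0 he he' hd₁ hd₁' x s t m ((x - y) / (2 * d₁)).val
    rw [hn, hs, hs', div_self hd₁, div_self hd₁', one_pow, one_mul, one_mul, one_mul] at h1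
    exact h1
  have hκ : ∀ c, c * e'.extend d₁ / e'.extend d₂ = e'.extend d₁ / e'.extend d₂ * c :=
    fun c => by ring
  have hμ : ∀ c, e.extend d₂ * (c / e.extend d₁) = e.extend d₂ / e.extend d₁ * c :=
    fun c => by ring
  refine commutator_le_of_bar_eq_one he' he0' (commutator_eq_one_of_rescaling
    (β := fun s => directedBar (Submodule.smul_mem _ s he')) rotBar_add
    (directedBar_smul_add he') hdet ?_ ?_)
  · intro s t m
    have h1 : ∀ d, e.extend d ≠ 0 → e'.extend d ≠ 0 → ∀ s t m : ZMod p, E.Linked 0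
        (directed j (m • e) * ⁅directed j (s • e), rot t⁆ * (directed j (m • e))⁻¹) 0
        (rot (e.extend d * m) * ⁅directed j' ((t / e'.extend d) • e'), rot (e.extend d * s)⁆ *
          (rot (e.extend d * m))⁻¹) := by
      intro d hd hd' s t m
      have h := (hdir 0 d s t m).trans (linked_step_directed (hdne hd) he he' hd' d s t m)
      rwa [hs, sub_self] at h
    have h3 := (h1 d₁ hd₁ hd₁' (t / e.extend d₁) (s * e'.extend d₁) (m / e.extend d₁)).symm.trans
      (h1 d₂ hd₂ hd₂' (t / e.extend d₁) (s * e'.extend d₁) (m / e.extend d₁))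
    refine conj_rotBar_eq he' (x := 0) ?_
    rw [mul_div_cancel₀ _ hd₁, mul_div_cancel₀ _ hd₁, mul_div_cancel_right₀ _ hd₁'] at h3
    simpa only [hκ, hμ] using h3
  · intro s t m
    have h1 : ∀ d, e.extend d ≠ 0 → e'.extend d ≠ 0 → ∀ s t m : ZMod p, E.Linked 0
        (rot m * ⁅directed j (s • e), rot t⁆ * (rot m)⁻¹) 0
        (directed j' ((m / e'.extend d) • e') *
          ⁅directed j' ((t / e'.extend d) • e'), rot (e.extend d * s)⁆ *
          (directed j' ((m / e'.extend d) • e'))⁻¹) := by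
      intro d hd hd' s t m
      have h := (hrot 0 d s t m).trans (linked_step_rot (hdne hd) he he' hd' d s t m)
      rwa [hs, sub_self] at h
    have h3 := (h1 d₁ hd₁ hd₁' (t / e.extend d₁) (s * e'.extend d₁) (m * e'.extend d₁)).symm.trans
      (h1 d₂ hd₂ hd₂' (t / e.extend d₁) (s * e'.extend d₁) (m * e'.extend d₁))
    refine conj_directedBar_eq he' (x := 0) ?_
    rw [mul_div_cancel₀ _ hd₁, mul_div_cancel_right₀ _ hd₁', mul_div_cancel_right₀ _ hd₁'] at h3
    simpa only [hκ, hμ] using h3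

variable (E)

/-- All conditions of being regular branch over the derived subgroup except for the inclusion
`G' × ⋯ × G' ⊆ ψ₁(G')` hold without any assumption. -/
theorem isRegularBranchOver (h : ⁅E.group, E.group⁆ ≤ E.localCommutator) :
    IsRegularBranchOver E.group ⁅E.group, E.group⁆ := by
  have hK : ∀ x, ∀ k ∈ ⁅E.group, E.group⁆, atLetter x k ∈ ⁅E.group, E.group⁆ :=
    fun x k hk => atLetter_mem_iff.2 (h hk)
  refine ⟨⟨E.isSphericallyTransitive, finiteIndex_rigidLevelStabilizer
    (fun g hg u => treeSection_mem hg u) (commutator_le_self _) hK E.finiteIndex_commutator⟩,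
    E.isSelfSimilar, E.commutator_ne_bot, E.commutator_le_levelStabilizer, ?_,
    E.finiteIndex_commutator⟩
  have hpi : Subgroup.pi Set.univ (fun _ : ZMod p => ⁅E.group, E.group⁆) ≤
      ⁅E.group, E.group⁆.comap diag := by
    rw [Subgroup.pi_le_iff]
    rintro x _ ⟨k, hk, rfl⟩
    exact hK x k hk
  exact fun k hk => ⟨⟨diag k, diag_mem_levelStabilizer k⟩, hpi hk, psiOne_diag k⟩

theorem commutator_le_localCommutator_of_condition (hp : Odd p)
    (h : (∃ (j : ZMod p) (i : Fin (E.r j)), ¬ (E.vec j i).IsSymmetric) ∨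
      2 ≤ Module.finrank (ZMod p) E.span) :
    ⁅E.group, E.group⁆ ≤ E.localCommutator := by
  by_cases hns : ∃ (j : ZMod p) (i : Fin (E.r j)), ¬ (E.vec j i).IsSymmetric
  · obtain ⟨j, i, hns⟩ := hns
    exact commutator_le_of_nonsymmetric hp (E.vec_mem_familySpan j i) hns
  have hdim := h.resolve_left hns
  push Not at hns
  obtain ⟨j, i, -⟩ := E.exists_vec
  obtain ⟨j', i', hind⟩ : ∃ j' i', ∀ c : ZMod p, c • E.vec j i ≠ E.vec j' i' := by
    by_contra! hall
    have hle : E.span ≤ ZMod p ∙ E.vec j i := by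
      refine Submodule.span_le.2 ?_
      rintro _ ⟨j', i', rfl⟩
      exact Submodule.mem_span_singleton.2 (hall j' i')
    have h1 := Submodule.finrank_mono hle
    rw [finrank_span_singleton (E.vec_ne_zero j i)] at h1
    omega
  exact commutator_le_of_symmetric hp (E.vec_mem_familySpan j i) (E.vec_mem_familySpan j' i')
    (hns j i) (hns j' i') (E.vec_ne_zero j i) hind

end NumericalDatum

/-! ### Iterated differences of functions on the residues -/

section Difference

variable {p : ℕ} [Fact p.Prime]

/-- The translation operator `w ↦ w (· + s)` on functions on the residues modulo `p`. -/
def translate (s : ZMod p) : Module.End (ZMod p) (ZMod p → ZMod p) :=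
  LinearMap.funLeft (ZMod p) (ZMod p) (· + s)

theorem translate_apply (s : ZMod p) (w : ZMod p → ZMod p) (x : ZMod p) :
    translate s w x = w (x + s) := rfl

/-- The forward difference operator `w ↦ w (· + 1) - w`. -/
def difference : Module.End (ZMod p) (ZMod p → ZMod p) := translate 1 - 1

theorem difference_apply (w : ZMod p → ZMod p) (x : ZMod p) :
    difference w x = w (x + 1) - w x := rfl

theorem difference_pow_translate (n : ℕ) (s : ZMod p) (w : ZMod p → ZMod p) :
    (difference ^ n) (translate s w) = translate s ((difference ^ n) w) := by
  have h : Commute (difference (p := p)) (translate s) := by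
    ext w x
    simp only [Module.End.mul_apply, difference_apply, translate_apply, LinearMap.coe_comp,
      Function.comp_apply]
    rw [add_right_comm]
  exact congrArg (fun f : Module.End (ZMod p) (ZMod p → ZMod p) => f w) (h.pow_left n).eq

theorem difference_pow_prime : (difference (p := p)) ^ p = 0 := by
  have h : ((Polynomial.X : Polynomial (ZMod p)) - 1) ^ p = Polynomial.X ^ p - 1 := by
    rw [sub_pow_char, one_pow]
  have h1 := congrArg (Polynomial.aeval (translate (1 : ZMod p))) h
  simp only [map_pow, map_sub, Polynomial.aeval_X, map_one] at h1
  rw [difference, h1, sub_eq_zero]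
  have h2 : ∀ n : ℕ, (translate (1 : ZMod p)) ^ n = translate (n : ZMod p) := by
    intro n
    induction n with
    | zero =>
      refine LinearMap.ext fun w => funext fun x => ?_
      rw [pow_zero, Module.End.one_apply, translate_apply, Nat.cast_zero, add_zero]
    | succ n ih =>
      refine LinearMap.ext fun w => funext fun x => ?_
      rw [pow_succ, ih, Module.End.mul_apply, translate_apply, translate_apply, translate_apply,
        Nat.cast_succ, add_assoc]
  rw [h2, CharP.cast_eq_zero]
  refine LinearMap.ext fun w => funext fun x => ?_
  rw [Module.End.one_apply, translate_apply, add_zero]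

/-- A function with vanishing second difference is affine. -/
theorem eq_add_mul_of_difference_eq_zero {u : ZMod p → ZMod p}
    (h : difference (difference u) = 0) (s : ZMod p) : u s = u 0 + s * difference u 0 := by
  have hconst : ∀ n : ℕ, difference u n = difference u 0 := by
    intro n
    induction n with
    | zero => rw [Nat.cast_zero]
    | succ n ih =>
      have h1 := congrFun h (n : ZMod p)
      rw [difference_apply, Pi.zero_apply, sub_eq_zero] at h1
      rw [Nat.cast_succ, h1, ih]
  have key : ∀ n : ℕ, u n = u 0 + n * difference u 0 := by
    intro n
    induction n with
    | zero => rw [Nat.cast_zero, zero_mul, add_zero]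
    | succ n ih =>
      have h1 := hconst n
      rw [difference_apply, sub_eq_iff_eq_add] at h1
      rw [Nat.cast_succ, h1, ih]
      ring
  rw [← ZMod.natCast_zmod_val s, key]

theorem eq_const_of_difference_eq_zero {u : ZMod p → ZMod p} (h : difference u = 0) (s : ZMod p) :
    u s = u 0 := by
  rw [eq_add_mul_of_difference_eq_zero (u := u) (by rw [h, map_zero]) s, h, Pi.zero_apply, mul_zero,
    add_zero]

theorem difference_pow_succ_apply (n : ℕ) (w : ZMod p → ZMod p) :
    (difference ^ (n + 1)) w = difference ((difference ^ n) w) := by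
  rw [pow_succ', Module.End.mul_apply]

/-- For a non-constant function, consider the last two non-vanishing iterated differences. -/
theorem exists_last_difference {v : ZMod p → ZMod p} (h : difference v ≠ 0) :
    ∃ k : ℕ, (difference ^ (k + 2)) v = 0 ∧ (difference ^ (k + 1)) v ≠ 0 := by
  classical
  have hex : ∃ n : ℕ, (difference ^ n) v = 0 := ⟨p, by rw [difference_pow_prime]; rfl⟩
  have h0 : Nat.find hex ≠ 0 := by
    intro h0
    have h1 := Nat.find_spec hex
    rw [h0, pow_zero, Module.End.one_apply] at h1
    exact h (by rw [h1, map_zero])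
  have h1 : Nat.find hex ≠ 1 := by
    intro h0
    have h1 := Nat.find_spec hex
    rw [h0, pow_one] at h1
    exact h h1
  obtain ⟨k, hk⟩ := Nat.exists_eq_add_of_le' (show 2 ≤ Nat.find hex by omega)
  refine ⟨k, ?_, ?_⟩
  · rw [← hk]
    exact Nat.find_spec hex
  · exact Nat.find_min hex (by omega)

theorem difference_pow_succ_translate_zero {k : ℕ} {w : ZMod p → ZMod p}
    (hw : (difference ^ (k + 2)) w = 0) (s : ZMod p) :
    (difference ^ (k + 1)) (translate s w) 0 = (difference ^ (k + 1)) w 0 := by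
  rw [difference_pow_translate, translate_apply, zero_add]
  exact eq_const_of_difference_eq_zero (by rw [← difference_pow_succ_apply, hw]) s

/-- If the differences of order `k + 2` of `w` vanish, the one of order `k` is affine. -/
theorem difference_pow_translate_zero {k : ℕ} {w : ZMod p → ZMod p}
    (hw : (difference ^ (k + 2)) w = 0) (s : ZMod p) :
    (difference ^ k) (translate s w) 0 =
      (difference ^ k) w 0 + s * (difference ^ (k + 1)) w 0 := by
  rw [difference_pow_translate, translate_apply, zero_add, difference_pow_succ_apply]
  refine eq_add_mul_of_difference_eq_zero ?_ s
  rw [← difference_pow_succ_apply, ← difference_pow_succ_apply, hw]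

end Difference

/-! ### Labels -/

section Label

variable {p : ℕ} [Fact p.Prime]

/-- The residue `s` such that `g` acts on the first level as `a ^ s`; it is only meaningful for
automorphisms acting in this way. -/
def rootLabel (g : TreeAut (ZMod p)) : ZMod p := (g [0]).headD 0

theorem rootLabel_eq {g : TreeAut (ZMod p)} {s : ZMod p} (h : g [0] = [s]) : rootLabel g = s := by
  rw [rootLabel, h]
  rfl

/-- The root labels of the sections at the letters. -/
def label (g : TreeAut (ZMod p)) (x : ZMod p) : ZMod p := rootLabel (treeSection g [x])

theorem rootLabel_one : rootLabel (1 : TreeAut (ZMod p)) = 0 := rootLabel_eq rfl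

theorem rootLabel_rot (s : ZMod p) : rootLabel (rot s) = s :=
  rootLabel_eq (by rw [rot_cons, zero_add])

theorem rootLabel_directed (j : ZMod p) (e : Vec p) : rootLabel (directed j e) = 0 :=
  rootLabel_eq (by rw [← directedAt_self, directedAt, diag_singleton])

theorem label_rot (s : ZMod p) : label (rot s) = 0 := by
  funext x
  rw [label, treeSection_rot, rootLabel_one, Pi.zero_apply]

theorem label_directed (j : ZMod p) (e : Vec p) :
    label (directed j e) = translate (-(1 - j)) e.extend := by
  funext x
  rw [label, translate_apply, ← sub_eq_add_neg]
  by_cases h : x = 1 - j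
  · rw [h, treeSection_directed_self, rootLabel_directed, sub_self, Vec.extend_zero_apply]
  · rw [treeSection_directed_of_ne j e h, rootLabel_rot]

end Label

/-! ### The obstruction for a single symmetric vector -/

namespace NumericalDatum

variable {p : ℕ} [Fact p.Prime] {E : NumericalDatum p} {f g : TreeAut (ZMod p)}

theorem apply_singleton (hg : g ∈ E.group) (x : ZMod p) : g [x] = [x + rootLabel g] := by
  obtain ⟨s, hs⟩ := E.exists_apply_singleton hg
  rw [hs, rootLabel_eq ((hs 0).trans (by rw [zero_add]))]

theorem rootLabel_mul (hf : f ∈ E.group) (hg : g ∈ E.group) :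
    rootLabel (f * g) = rootLabel f + rootLabel g := by
  refine rootLabel_eq ?_
  change f (g [0]) = _
  rw [apply_singleton hg, apply_singleton hf, zero_add, add_comm]

theorem treeSection_mul_singleton (hg : g ∈ E.group) (x : ZMod p) :
    treeSection (f * g) [x] = treeSection f [x + rootLabel g] * treeSection g [x] := by
  rw [treeSection_mul, apply_singleton hg]

theorem label_mul (hf : f ∈ E.group) (hg : g ∈ E.group) :
    label (f * g) = translate (rootLabel g) (label f) + label g := by
  funext x
  rw [label, treeSection_mul_singleton hg,
    rootLabel_mul (treeSection_mem hf _) (treeSection_mem hg _)]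
  rfl

/-- A cocycle on the group with values in the functions on the first level takes values in a
translation invariant subspace as soon as its values at the generators lie in there. -/
theorem cocycle_mem {D : TreeAut (ZMod p) → ZMod p → ZMod p}
    {L : Submodule (ZMod p) (ZMod p → ZMod p)} (hL : ∀ w ∈ L, ∀ s, translate s w ∈ L)
    (hD : ∀ f ∈ E.group, ∀ g ∈ E.group, D (f * g) = translate (rootLabel g) (D f) + D g)
    (hrot : D (rot 1) ∈ L) (hdir : ∀ j i, D (directed j (E.vec j i)) ∈ L) (hg : g ∈ E.group) :
    D g ∈ L := by
  have hone : D 1 = 0 := by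
    have h := hD 1 (Subgroup.one_mem _) 1 (Subgroup.one_mem _)
    have h1 : translate (rootLabel (1 : TreeAut (ZMod p))) (D 1) = D 1 := by
      funext x
      rw [rootLabel_one, translate_apply, add_zero]
    rwa [one_mul, h1, left_eq_add] at h
  induction hg using group_induction with
  | rot => exact hrot
  | directed j i => exact hdir j i
  | one => rw [hone]; exact L.zero_mem
  | mul f g hf hg ihf ihg => rw [hD f hf g hg]; exact L.add_mem (hL _ ihf _) ihg
  | inv g hg ih =>
    have h := hD g hg g⁻¹ (Subgroup.inv_mem _ hg)
    rw [mul_inv_cancel, hone] at h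
    rw [eq_neg_of_add_eq_zero_right h.symm]
    exact L.neg_mem (hL _ ih _)

theorem eq_zero_of_mem_commutator {W : TreeAut (ZMod p) → ZMod p}
    (hW : ∀ f ∈ E.group, ∀ g ∈ E.group, W (f * g) = W f + W g)
    (hg : g ∈ ⁅E.group, E.group⁆) : W g = 0 := by
  let φ : E.group →* Multiplicative (ZMod p) :=
    MonoidHom.mk' (fun g => Multiplicative.ofAdd (W g)) fun f g => by
      rw [← ofAdd_add, ← hW f f.2 g g.2]
      rfl
  have hle : ⁅E.group, E.group⁆ ≤ φ.ker.map E.group.subtype := by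
    rw [Subgroup.commutator_le]
    intro f hf g hg
    refine ⟨⁅(⟨f, hf⟩ : E.group), ⟨g, hg⟩⁆, ?_, rfl⟩
    change φ _ = 1
    rw [map_commutatorElement, commutatorElement_eq_one_iff_commute]
    exact Commute.all _ _
  obtain ⟨h, hh, rfl⟩ := hle hg
  exact hh

/-- If all defining vectors are multiples of one symmetric vector, then there is a homomorphism
from the group to `𝔽_p` that does not vanish on the commutator of two generators placed on a
single subtree. -/
theorem not_commutator_le_localCommutator (hp : Odd p) {j₀ : ZMod p} {i₀ : Fin (E.r j₀)}
    (hs : (E.vec j₀ i₀).IsSymmetric) (hall : ∀ j i, ∃ c : ZMod p, c • E.vec j₀ i₀ = E.vec j i) :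
    ¬ ⁅E.group, E.group⁆ ≤ E.localCommutator := by
  intro hle
  set v : ZMod p → ZMod p := (E.vec j₀ i₀).extend with hv
  have hsym : ∀ x, v (-x) = v x := (Vec.isSymmetric_iff _).1 hs
  obtain ⟨k, hk, hk1⟩ : ∃ k : ℕ, (difference ^ (k + 2)) v = 0 ∧ (difference ^ (k + 1)) v ≠ 0 := by
    refine exists_last_difference fun h => ?_
    obtain ⟨d, hd⟩ := exists_extend_ne_zero (E.vec_ne_zero j₀ i₀)
    exact hd ((eq_const_of_difference_eq_zero h d).trans (Vec.extend_zero_apply _))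
  set ε₀ := (difference ^ (k + 1)) v 0 with hε₀
  have hε₀' : ε₀ ≠ 0 := fun h => hk1 <| funext fun x =>
    (eq_const_of_difference_eq_zero (by rw [← difference_pow_succ_apply, hk]) x).trans h
  have hlabel : ∀ g ∈ E.group, (difference ^ (k + 2)) (label g) = 0 := by
    intro g hg
    refine LinearMap.mem_ker.1 (cocycle_mem (L := LinearMap.ker (difference ^ (k + 2))) ?_
      (fun f hf g hg => label_mul hf hg) ?_ ?_ hg)
    · intro w hw s
      rw [LinearMap.mem_ker] at hw ⊢
      rw [difference_pow_translate, hw, map_zero]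
    · rw [label_rot]
      exact Submodule.zero_mem _
    · intro j i
      obtain ⟨c, hc⟩ := hall j i
      rw [LinearMap.mem_ker, label_directed, ← hc, difference_pow_translate, map_smul, map_smul,
        hk, smul_zero, map_zero]
  set ε : TreeAut (ZMod p) → ZMod p := fun g => (difference ^ (k + 1)) (label g) 0 with hε
  set η : TreeAut (ZMod p) → ZMod p := fun g => (difference ^ k) (label g) 0 with hη
  have hε_mul : ∀ f ∈ E.group, ∀ g ∈ E.group, ε (f * g) = ε f + ε g := by
    intro f hf g hg
    simp only [hε]
    rw [label_mul hf hg, map_add, Pi.add_apply, difference_pow_succ_translate_zero (hlabel f hf)]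
  have hη_mul : ∀ f ∈ E.group, ∀ g ∈ E.group,
      η (f * g) = η f + rootLabel g * ε f + η g := by
    intro f hf g hg
    simp only [hε, hη]
    rw [label_mul hf hg, map_add, Pi.add_apply, difference_pow_translate_zero (hlabel f hf)]
  have hε_rot : ∀ s, ε (rot s) = 0 := fun s => by
    simp only [hε, label_rot, map_zero, Pi.zero_apply]
  have hη_rot : ∀ s, η (rot s) = 0 := fun s => by
    simp only [hη, label_rot, map_zero, Pi.zero_apply]
  have hε_dir : ∀ j (c : ZMod p), ε (directed j (c • E.vec j₀ i₀)) = c * ε₀ := by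
    intro j c
    simp only [hε]
    rw [label_directed,
      difference_pow_succ_translate_zero (by rw [map_smul, map_smul, hk, smul_zero]), map_smul,
      map_smul, Pi.smul_apply, smul_eq_mul]
  -- The function `N g` records the exponents of the directed generators in the sections of `g`.
  set N : TreeAut (ZMod p) → ZMod p → ZMod p := fun g x => ε (treeSection g [x]) with hN
  have hN_mul : ∀ f ∈ E.group, ∀ g ∈ E.group, ∀ x,
      N (f * g) x = N f (x + rootLabel g) + N g x := by
    intro f hf g hg x
    simp only [hN]
    rw [treeSection_mul_singleton hg, hε_mul _ (treeSection_mem hf _) _ (treeSection_mem hg _)]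
  -- The labels are the convolution of the exponents with the defining vector.
  have hconv : ∀ g ∈ E.group, ∀ x, ε₀ * label g x = ∑ y, v (x - y) * N g y := by
    intro g hg x
    have h := cocycle_mem (E := E) (L := ⊥)
      (D := fun g x => ε₀ * label g x - ∑ y, v (x - y) * N g y) ?_ ?_ ?_ ?_ hg
    · exact sub_eq_zero.1 (congrFun ((Submodule.mem_bot _).1 h) x)
    · intro w hw s
      rw [(Submodule.mem_bot _).1 hw, map_zero]
      exact Submodule.zero_mem _
    · intro f hf g hg
      funext x
      simp only [Pi.add_apply, translate_apply, label_mul hf hg, hN_mul f hf g hg, mul_add,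
        Finset.sum_add_distrib]
      have h1 : ∑ y, v (x - y) * N f (y + rootLabel g) =
          ∑ y, v (x + rootLabel g - y) * N f y :=
        Fintype.sum_equiv (Equiv.addRight (rootLabel g)) _ _ fun y => by
          rw [Equiv.coe_addRight, add_sub_add_right_eq_sub]
      rw [h1]
      ring
    · refine (Submodule.mem_bot _).2 (funext fun x => ?_)
      simp only [label_rot, hN, treeSection_rot]
      rw [← rot_zero]
      simp only [hε_rot, Pi.zero_apply, mul_zero, Finset.sum_const_zero, sub_zero]
    · intro j i
      obtain ⟨c, hc⟩ := hall j i
      refine (Submodule.mem_bot _).2 (funext fun x => ?_)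
      rw [← hc]
      simp only [label_directed, hN]
      rw [Finset.sum_eq_single (1 - j), treeSection_directed_self, hε_dir, translate_apply,
        map_smul, Pi.smul_apply, smul_eq_mul, Pi.zero_apply, ← sub_eq_add_neg]
      · ring
      · intro y _ hy
        rw [treeSection_directed_of_ne j _ hy, hε_rot, mul_zero]
      · intro h
        exact absurd (Finset.mem_univ _) h
  -- The sum of the values of `η` at the sections fails to be additive by the bilinear form with
  -- matrix `v (x - y)`; as `v` is symmetric, the associated quadratic form corrects this.
  set W : TreeAut (ZMod p) → ZMod p := fun g =>
    2 * ε₀ * ∑ x, η (treeSection g [x]) - ∑ x, ∑ y, v (x - y) * (N g x * N g y) with hW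
  have hW_mul : ∀ f ∈ E.group, ∀ g ∈ E.group, W (f * g) = W f + W g := by
    intro f hf g hg
    set s := rootLabel g with hs
    have h1 : ∑ x, η (treeSection (f * g) [x]) = ∑ x, η (treeSection f [x]) +
        ∑ x, label g x * N f (x + s) + ∑ x, η (treeSection g [x]) := by
      rw [← Equiv.sum_comp (Equiv.addRight s) fun x => η (treeSection f [x]),
        ← Finset.sum_add_distrib, ← Finset.sum_add_distrib]
      refine Finset.sum_congr rfl fun x _ => ?_
      rw [treeSection_mul_singleton hg, hη_mul _ (treeSection_mem hf _) _ (treeSection_mem hg _)]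
      rfl
    have h2 : ε₀ * ∑ x, label g x * N f (x + s) =
        ∑ x, ∑ y, v (x - y) * (N f (x + s) * N g y) := by
      rw [Finset.mul_sum]
      refine Finset.sum_congr rfl fun x _ => ?_
      rw [← mul_assoc, hconv g hg, Finset.sum_mul]
      exact Finset.sum_congr rfl fun y _ => by ring
    have h3 : ∑ x, ∑ y, v (x - y) * (N g x * N f (y + s)) =
        ∑ x, ∑ y, v (x - y) * (N f (x + s) * N g y) := by
      rw [Finset.sum_comm]
      refine Finset.sum_congr rfl fun x _ => Finset.sum_congr rfl fun y _ => ?_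
      rw [← hsym, neg_sub, mul_comm (N g y)]
    have h4 : ∑ x, ∑ y, v (x - y) * (N f (x + s) * N f (y + s)) =
        ∑ x, ∑ y, v (x - y) * (N f x * N f y) := by
      refine Fintype.sum_equiv (Equiv.addRight s) _ _ fun x => ?_
      refine Fintype.sum_equiv (Equiv.addRight s) _ _ fun y => ?_
      simp only [Equiv.coe_addRight, add_sub_add_right_eq_sub]
    have h5 : ∑ x, ∑ y, v (x - y) * (N (f * g) x * N (f * g) y) =
        ∑ x, ∑ y, v (x - y) * (N f (x + s) * N f (y + s)) +
        ∑ x, ∑ y, v (x - y) * (N f (x + s) * N g y) +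
        ∑ x, ∑ y, v (x - y) * (N g x * N f (y + s)) +
        ∑ x, ∑ y, v (x - y) * (N g x * N g y) := by
      simp only [← Finset.sum_add_distrib]
      refine Finset.sum_congr rfl fun x _ => Finset.sum_congr rfl fun y _ => ?_
      rw [hN_mul f hf g hg, hN_mul f hf g hg]
      ring
    simp only [hW]
    rw [h1, h5, h4, h3, ← h2]
    ring
  set b := directed j₀ (E.vec j₀ i₀) with hb
  have hbG : b ∈ E.group := E.directed_vec_mem j₀ i₀
  have haG : rot (1 : ZMod p) ∈ E.group := E.rot_mem 1
  have hcG' : ⁅rot (1 : ZMod p), b⁆ ∈ ⁅E.group, E.group⁆ :=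
    Subgroup.commutator_mem_commutator haG hbG
  have hcG := commutator_le_self _ hcG'
  have hεc : ε ⁅rot (1 : ZMod p), b⁆ = 0 := eq_zero_of_mem_commutator hε_mul hcG'
  have hεb : ε b = ε₀ := by
    have h := hε_dir j₀ 1
    rwa [one_smul, one_mul] at h
  have hηc : η ⁅rot (1 : ZMod p), b⁆ = -ε₀ := by
    have h1 : ⁅rot (1 : ZMod p), b⁆ * (b * rot 1) = rot 1 * b := by
      rw [commutatorElement_def]
      group
    have h2 := hη_mul _ hcG _ (E.group.mul_mem hbG haG)
    rw [h1, hη_mul _ haG _ hbG, hη_mul _ hbG _ haG, hεc, hη_rot, hε_rot, hεb, rootLabel_rot] at h2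
    linear_combination -h2
  have hW0 := eq_zero_of_mem_commutator hW_mul (atLetter_mem_iff (x := 0).2 (hle hcG'))
  have hN0 : N (atLetter 0 ⁅rot (1 : ZMod p), b⁆) = 0 := by
    funext x
    simp only [hN]
    rw [treeSection_atLetter]
    split_ifs
    · exact hεc
    · rw [← rot_zero]
      exact hε_rot 0
  have hη0 : ∑ x, η (treeSection (atLetter 0 ⁅rot (1 : ZMod p), b⁆) [x]) = -ε₀ := by
    rw [Finset.sum_eq_single 0, treeSection_atLetter, if_pos rfl, hηc]
    · intro x _ hx
      rw [treeSection_atLetter, if_neg hx, ← rot_zero]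
      exact hη_rot 0
    · intro h
      exact absurd (Finset.mem_univ _) h
  simp only [hW] at hW0
  rw [hη0, hN0] at hW0
  simp only [Pi.zero_apply, mul_zero, Finset.sum_const_zero, sub_zero, mul_neg, neg_eq_zero,
    mul_eq_zero, hε₀', or_false] at hW0
  exact two_ne_zero_of_odd hp hW0

end NumericalDatum

/-! ### The characterisation -/

namespace NumericalDatum

variable {p : ℕ} [Fact p.Prime] {E : NumericalDatum p}

/-- The inclusion `G' × ⋯ × G' ⊆ ψ₁(G')`, applied to tuples with a single non-trivial entry. -/
theorem commutator_le_of_isRegularBranchOver (h : IsRegularBranchOver E.group ⁅E.group, E.group⁆) :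
    ⁅E.group, E.group⁆ ≤ E.localCommutator := by
  intro k hk
  have hmem : (Pi.mulSingle 0 k : ZMod p → TreeAut (ZMod p)) ∈
      Subgroup.pi Set.univ (fun _ : ZMod p => ⁅E.group, E.group⁆) := by
    intro x _
    rw [Pi.mulSingle_apply]
    split_ifs
    · exact hk
    · exact Subgroup.one_mem _
  obtain ⟨g, hg, hgk⟩ := h.pi_le hmem
  change atLetter 0 k ∈ ⁅E.group, E.group⁆
  rw [atLetter_eq, ← hgk]
  exact (diag_treeSection (apply_singleton_of_mem g.2)).symm ▸ hg

theorem condition_of_isRegularBranchOver (hp : Odd p)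
    (h : IsRegularBranchOver E.group ⁅E.group, E.group⁆) :
    (∃ (j : ZMod p) (i : Fin (E.r j)), ¬ (E.vec j i).IsSymmetric) ∨
      2 ≤ Module.finrank (ZMod p) E.span := by
  by_contra! hcon
  obtain ⟨hsym, hdim⟩ := hcon
  obtain ⟨j₀, i₀, -⟩ := E.exists_vec
  have hle : ZMod p ∙ E.vec j₀ i₀ ≤ E.span :=
    (Submodule.span_singleton_le_iff_mem _ _).2 (Submodule.subset_span ⟨j₀, i₀, rfl⟩)
  have heq := Submodule.eq_of_le_of_finrank_le hle (by
    rw [finrank_span_singleton (E.vec_ne_zero j₀ i₀)]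
    omega)
  refine not_commutator_le_localCommutator hp (hsym j₀ i₀) (fun j i => ?_)
    (commutator_le_of_isRegularBranchOver h)
  rw [← Submodule.mem_span_singleton, heq]
  exact Submodule.subset_span ⟨j, i, rfl⟩

end NumericalDatum

end MultiEGS

theorem proposition3p2 (p : ℕ) [Fact p.Prime] (hp : Odd p) (E : MultiEGS.NumericalDatum p) :
    MultiEGS.IsRegularBranchOver E.group ⁅E.group, E.group⁆ ↔
      ((∃ (j : ZMod p) (i : Fin (E.r j)), ¬ (E.vec j i).IsSymmetric) ∨
        2 ≤ Module.finrank (ZMod p) E.span) :=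
  ⟨MultiEGS.NumericalDatum.condition_of_isRegularBranchOver hp, fun h =>
    E.isRegularBranchOver (E.commutator_le_localCommutator_of_condition hp h)⟩
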